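/- Throughout, matroids have finite ground sets. For $0\le k\le n$ let $\mathsf{U}_{k,n}$ be the uniform matroid of rank $k$ on $n$ elements, and let $\mathsf{T}_{k,n}$ be the minimal matroid, i.e. the matroid on $\{1,\dots,n\}$ whose bases are the $k$-element subsets $B$ with $|B\cap\{1,\dots,k\}|\ge k-1$. A matroid is \emph{Schubert} (or \emph{nested}) if its cyclic flats (the flats that are unions of circuits, the empty union being allowed) form a chain under inclusion; it is \emph{binary} if it is representable over the field with two elements; and it is \emph{graphic} if it is isomorphic to the cycle matroid of a finite graph (loops and parallel edges allowed). \textbf{Proposition.} Let $\mathsf{M}$ be a matroid of rank $k$ on a ground set with $n$ elements. The following conditions are equivalent: \begin{enumerate} \item[(i)] $\mathsf{M}$ is isomorphic to $\mathsf{U}_{0,m}\oplus\mathsf{T}_{k-\ell,\,n-\ell-m}\oplus\mathsf{U}_{\ell,\ell}$ for some integers $0\le \ell\le k$ and $0\le m\le n-k$. \item[(ii)] $\mathsf{M}$ has no minor isomorphic to $\mathsf{U}_{2,4}$ and no minor isomorphic to $\mathsf{U}_{1,2}\oplus\mathsf{U}_{1,2}$. \item[(iii)] $\mathsf{M}$ is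 binary and Schubert. \item[(iv)] $\mathsf{M}$ is graphic and Schubert. \end{enumerate} -/

import Mathlib

namespace Matroid

/-- Two matroids are isomorphic if some bijection between their ground sets preserves
independence in both directions. -/
def IsIsomorphicTo {α β : Type*} (M : Matroid α) (N : Matroid β) : Prop :=
  ∃ e : M.E ≃ N.E, ∀ I : Set M.E,
    M.Indep (Subtype.val '' I) ↔ N.Indep (Subtype.val '' (e '' I))

/-- `M` has a minor isomorphic to `N`. -/
def HasMinorIsoTo {α β : Type*} (M : Matroid α) (N : Matroid β) : Prop :=
  ∃ M' : Matroid α, M' ≤m M ∧ M'.IsIsomorphicTo N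

/-- The uniform matroid `U_{k,n}` on `Fin n`: the independent sets are the sets with at most `k`
elements (used for `k ≤ n`). -/
def uniformMatroid (k n : ℕ) : Matroid (Fin n) :=
  (IndepMatroid.ofFinite (E := Set.univ) Set.finite_univ (fun I : Set (Fin n) ↦ I.ncard ≤ k)
    (by simp)
    (fun I J hJ hIJ ↦ (Set.ncard_le_ncard hIJ (Set.toFinite J)).trans hJ)
    (by
      intro I J hI hJ hlt
      obtain ⟨e, heJ, heI⟩ := Set.exists_mem_notMem_of_ncard_lt_ncard hlt (Set.toFinite I)
      refine ⟨e, heJ, heI, ?_⟩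
      rw [Set.ncard_insert_of_notMem heI (Set.toFinite I)]
      omega)
    (fun I _ ↦ Set.subset_univ I)).matroid

/-- The minimal matroid `T_{k,n}` on `Fin n` (used for `k ≤ n`), given by its independent sets.
Its bases are the `k`-element sets `B` with `k - 1 ≤ |B ∩ {0, …, k - 1}|`; see
`minimalMatroid_isBase_iff`. -/
def minimalMatroid (k n : ℕ) : Matroid (Fin n) :=
  (IndepMatroid.ofFinite (E := Set.univ) Set.finite_univ
    (fun I : Set (Fin n) ↦ I.ncard ≤ k ∧ {i | i ∈ I ∧ k ≤ i.val}.ncard ≤ 1)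
    (by simp)
    (by
      rintro I J ⟨hJ, hJ'⟩ hIJ
      have hsub : {i | i ∈ I ∧ k ≤ i.val} ⊆ {i | i ∈ J ∧ k ≤ i.val} :=
        fun i hi ↦ ⟨hIJ hi.1, hi.2⟩
      exact ⟨(Set.ncard_le_ncard hIJ (Set.toFinite J)).trans hJ,
        (Set.ncard_le_ncard hsub (Set.toFinite _)).trans hJ'⟩)
    (by
      rintro I J ⟨-, hI⟩ ⟨hJ, hJ'⟩ hlt
      by_cases h : ∃ e ∈ J, e ∉ I ∧ e.val < k
      · obtain ⟨e, heJ, heI, hek⟩ := h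
        refine ⟨e, heJ, heI, ?_, ?_⟩
        · rw [Set.ncard_insert_of_notMem heI (Set.toFinite I)]
          omega
        · convert hI using 2
          ext i
          simp only [Set.mem_insert_iff, Set.mem_ofPred_eq]
          constructor
          · rintro ⟨rfl | hi, hk⟩
            · omega
            · exact ⟨hi, hk⟩
          · exact fun hi ↦ ⟨Or.inr hi.1, hi.2⟩
      · push Not at h
        obtain ⟨e, heJ, heI⟩ := Set.exists_mem_notMem_of_ncard_lt_ncard hlt (Set.toFinite I)
        refine ⟨e, heJ, heI, ?_, ?_⟩
        · rw [Set.ncard_insert_of_notMem heI (Set.toFinite I)]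
          omega
        · have hJI : ∀ i ∈ J, i ≠ e → i ∈ I := by
            intro i hi hie
            by_contra hiI
            exact hie ((Set.ncard_le_one (Set.toFinite _)).1 hJ' i ⟨hi, h i hi hiI⟩ e
              ⟨heJ, h e heJ heI⟩)
          have hJle : J ⊆ insert e I := by
            intro i hi
            by_cases hie : i = e
            · exact Or.inl hie
            · exact Or.inr (hJI i hi hie)
          have hcard : (insert e I).ncard ≤ J.ncard := by
            rw [Set.ncard_insert_of_notMem heI (Set.toFinite I)]
            omega
          rw [← Set.eq_of_subset_of_ncard_le hJle hcard (Set.toFinite _)]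
          exact hJ')
    (fun I _ ↦ Set.subset_univ I)).matroid

@[simp] theorem uniformMatroid_ground (k n : ℕ) : (uniformMatroid k n).E = Set.univ := rfl

@[simp] theorem uniformMatroid_indep_iff {k n : ℕ} {I : Set (Fin n)} :
    (uniformMatroid k n).Indep I ↔ I.ncard ≤ k := Iff.rfl

@[simp] theorem minimalMatroid_ground (k n : ℕ) : (minimalMatroid k n).E = Set.univ := rfl

@[simp] theorem minimalMatroid_indep_iff {k n : ℕ} {I : Set (Fin n)} :
    (minimalMatroid k n).Indep I ↔ I.ncard ≤ k ∧ {i | i ∈ I ∧ k ≤ i.val}.ncard ≤ 1 := Iff.rfl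

/-- For `k ≤ n`, the bases of `T_{k,n}` are the `k`-element subsets of `Fin n` that contain at
least `k - 1` of the first `k` elements. -/
theorem minimalMatroid_isBase_iff {k n : ℕ} (hkn : k ≤ n) {B : Set (Fin n)} :
    (minimalMatroid k n).IsBase B ↔
      B.ncard = k ∧ k ≤ (B ∩ {i | i.val < k}).ncard + 1 := by
  have hsplit : ∀ S : Set (Fin n),
      (S ∩ {i | i.val < k}).ncard + {i | i ∈ S ∧ k ≤ i.val}.ncard = S.ncard := by
    intro S
    rw [← Set.ncard_inter_add_ncard_sdiff_eq_ncard S {i | i.val < k} (Set.toFinite _)]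
    congr 2
    ext i
    simp
  have hF : ({i | i.val < k} : Set (Fin n)).ncard = k := by
    have h : ({i | i.val < k} : Set (Fin n)) = Set.range (Fin.castLE hkn) := by
      ext i
      simp only [Set.mem_ofPred_eq, Set.mem_range]
      exact ⟨fun h ↦ ⟨⟨i.val, h⟩, rfl⟩, fun ⟨j, hj⟩ ↦ hj ▸ j.isLt⟩
    rw [h, ← Set.image_univ, Set.ncard_image_of_injective _ (Fin.castLE_injective hkn),
      Set.ncard_univ, Nat.card_fin]
  have hFi : (minimalMatroid k n).Indep {i | i.val < k} := by
    refine minimalMatroid_indep_iff.2 ⟨hF.le, ?_⟩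
    have := hsplit {i | i.val < k}
    rw [Set.inter_self] at this
    omega
  constructor
  · intro hB
    obtain ⟨h1, h2⟩ := minimalMatroid_indep_iff.1 hB.indep
    have hle : k ≤ B.ncard := by
      obtain ⟨B', hB', hsub⟩ := hFi.exists_isBase_superset
      rw [hB.ncard_eq_ncard_of_isBase hB', ← hF]
      exact Set.ncard_le_ncard hsub (Set.toFinite _)
    have := hsplit B
    omega
  · rintro ⟨h1, h2⟩
    have hBi : (minimalMatroid k n).Indep B := by
      refine minimalMatroid_indep_iff.2 ⟨h1.le, ?_⟩
      have := hsplit B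
      omega
    obtain ⟨B', hB', hsub⟩ := hBi.exists_isBase_superset
    have hB'k := (minimalMatroid_indep_iff.1 hB'.indep).1
    rwa [Set.eq_of_subset_of_ncard_le hsub (by omega) (Set.toFinite _)]

/-- The direct sum `U_{0,m} ⊕ T_{k,n} ⊕ U_{l,l}`. -/
def minimalWithLoopsColoops (m k n l : ℕ) : Matroid (Fin m ⊕ (Fin n ⊕ Fin l)) :=
  (uniformMatroid 0 m).sum ((minimalMatroid k n).sum (uniformMatroid l l))

/-- A cyclic flat is a flat that is a (possibly empty) union of circuits. -/
def IsCyclicFlat {α : Type*} (M : Matroid α) (F : Set α) : Prop :=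
  M.IsFlat F ∧ ∃ 𝒞 : Set (Set α), (∀ C ∈ 𝒞, M.IsCircuit C) ∧ F = ⋃₀ 𝒞

/-- A Schubert (or nested) matroid: its cyclic flats form a chain under inclusion. -/
def IsSchubert {α : Type*} (M : Matroid α) : Prop :=
  IsChain (· ⊆ ·) {F : Set α | M.IsCyclicFlat F}

/-- `M` (on a finite ground set) is representable over the field `𝕜`: it is the vector matroid of
the columns of a matrix with finitely many rows, the columns being indexed by the elements. -/
def IsRepresentableOver {α : Type*} (M : Matroid α) (𝕜 : Type*) [Field 𝕜] : Prop :=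
  ∃ (r : ℕ) (v : α → (Fin r → 𝕜)), ∀ I : Set α, I ⊆ M.E → (M.Indep I ↔ LinearIndepOn 𝕜 v I)

/-- A binary matroid: representable over the two-element field. -/
def IsBinary {α : Type*} (M : Matroid α) : Prop :=
  M.IsRepresentableOver (ZMod 2)

/-- `C` is the edge set of a cycle of the multigraph `G`: there are `p + 1` distinct vertices
`v 0, …, v p` and `p + 1` distinct edges `e 0, …, e p` such that `e i` joins `v i` to `v (i + 1)`,
with indices modulo `p + 1`. For `p = 0` this is a loop, for `p = 1` a pair of parallel edges. -/
def _root_.Graph.IsCycleEdgeSet {V α : Type*} (G : Graph V α) (C : Set α) : Prop :=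
  ∃ (p : ℕ) (v : Fin (p + 1) → V) (e : Fin (p + 1) → α),
    Function.Injective v ∧ Function.Injective e ∧
      (∀ i, G.IsLink (e i) (v i) (v (i + 1))) ∧ C = Set.range e

/-- `M` (on a finite ground set) is graphic: it is the cycle matroid of a finite multigraph whose
edges are the elements of `M`, that is, the circuits of `M` are exactly the edge sets of the cycles
of the graph. -/
def IsGraphic {α : Type*} (M : Matroid α) : Prop :=
  ∃ (V : Type) (_ : Finite V) (G : Graph V α),
    G.edgeSet = M.E ∧ ∀ C : Set α, M.IsCircuit C ↔ G.IsCycleEdgeSet C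

end Matroid

/-! All four conditions are compared with the existence of a partition of the ground set into loops
`L`, coloops `K`, mutually parallel elements `P`, and a set `S` such that `S ∪ {p}` is a circuit for
every `p ∈ P` (`IsMinimalPartition`). The independent sets are determined by the partition, so the
matroid is determined up to isomorphism by four cardinalities, and having such a partition amounts
to (i) (`exists_isMinimalPartition_iff`).

A partition gives (iv). The matroid is the cycle matroid of a path with extra edges: `S` is an
initial segment of the path, the elements of `P` join the ends of that segment, `K` continues the
path, and `L` consists of loops. The only possible cyclic flats are `L`, `L ∪ P` and `L ∪ S ∪ P`.
Next, (iv) implies (iii) because incidence vectors modulo 2 represent a cycle matroid. For (iii)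
implies (ii), circuits of a minor are lifted to circuits of `M`: over the two-element field the
symmetric difference of two circuits is a disjoint union of circuits, which excludes `U_{2,4}`, and
the closures of two circuits are comparable cyclic flats, which excludes `U_{1,2} ⊕ U_{1,2}`.

The substance is (ii) implies the partition. For a base `B`, the traces on `B` of the fundamental
circuits form a chain (`fundCircuit_comparable`), so the largest one gives a circuit `C` that spans
together with the coloops. Every nonloop in the closure of `C` outside `C` is parallel to an element
of `C` (`exists_parallel_mem_isCircuit`), and a single `c ∈ C` serves for all of them
(`exists_common_parallel`). Then `S = C \ {c}`, and `P` consists of `c` and the nonloops in the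
closure of `C` outside `C`. -/

namespace Graph

/-! ### Cycles and even edge sets of a graph. -/

variable {V α : Type*} {G : Graph V α} {e : α} {u w : V} {C : Set α} {D D' : Finset α}

open Classical in
/-- The incidence vector of an edge over the two-element field (zero for a loop). -/
noncomputable def incVec (G : Graph V α) (e : α) : V → ZMod 2 :=
  if h : ∃ p : V × V, G.IsLink e p.1 p.2 then
    Pi.single h.choose.1 1 + Pi.single h.choose.2 1 else 0

open Classical in
lemma IsLink.incVec_eq (h : G.IsLink e u w) :
    G.incVec e = Pi.single u 1 + Pi.single w 1 := by
  have hex : ∃ p : V × V, G.IsLink e p.1 p.2 := ⟨(u, w), h⟩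
  rw [incVec, dif_pos hex]
  obtain ⟨h1, h2⟩ | ⟨h1, h2⟩ := hex.choose_spec.eq_and_eq_or_eq_and_eq h
  · rw [h1, h2]
  · rw [h1, h2, add_comm]

/-- A nonempty finite set of edges meeting every vertex an even number of times. -/
def IsEvenSet (G : Graph V α) (D : Finset α) : Prop :=
  D.Nonempty ∧ (D : Set α) ⊆ G.edgeSet ∧ ∑ e ∈ D, G.incVec e = 0

open Fin.CommRing in
lemma fin_mem_of_add_one_mem {p : ℕ} {T : Set (Fin (p + 1))} (hT : T.Nonempty)
    (h : ∀ i ∈ T, i + 1 ∈ T) (j : Fin (p + 1)) : j ∈ T := by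
  obtain ⟨i, hi⟩ := hT
  have key : ∀ n : ℕ, i + (n : Fin (p + 1)) ∈ T := by
    intro n
    induction n with
    | zero => simpa using hi
    | succ n ih => simpa [add_assoc] using h _ ih
  have := key (j - i).val
  rwa [Fin.cast_val_eq_self, add_sub_cancel] at this

/-- For minimality: at the vertex `v (i + 1)` the cycle has only the edges `e i` and `e (i + 1)`, so
an even subset containing the first contains the second, and hence goes all the way round. -/
lemma IsCycleEdgeSet.exists_isEvenSet (hC : G.IsCycleEdgeSet C) :
    ∃ D : Finset α, (D : Set α) = C ∧ G.IsEvenSet D ∧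
      ∀ D' ⊆ D, G.IsEvenSet D' → D' = D := by
  classical
  obtain ⟨p, v, e, hv, he, hlink, rfl⟩ := hC
  refine ⟨Finset.univ.image e, by simp, ⟨by simp, ?_, ?_⟩, ?_⟩
  · simp only [Finset.coe_image, Finset.coe_univ, Set.image_univ]
    rintro _ ⟨i, rfl⟩
    exact (hlink i).edge_mem
  · rw [Finset.sum_image (he.injOn)]
    simp_rw [fun i ↦ (hlink i).incVec_eq, Finset.sum_add_distrib]
    have hshift := Equiv.sum_comp (Equiv.addRight (1 : Fin (p + 1)))
      (fun i ↦ (Pi.single (v i) 1 : V → ZMod 2))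
    simp only [Equiv.coe_addRight] at hshift
    rw [hshift]
    exact funext fun _ ↦ CharTwo.add_self_eq_zero _
  · rintro D' hD' ⟨hne, _, hsum⟩
    have hT : D' = (Finset.univ.filter (fun i ↦ e i ∈ D')).image e := by
      ext x
      constructor
      · intro hx
        obtain ⟨i, -, rfl⟩ := Finset.mem_image.1 (hD' hx)
        exact Finset.mem_image_of_mem _ (by simpa using hx)
      · intro hx
        obtain ⟨i, hi, rfl⟩ := Finset.mem_image.1 hx
        simpa using hi
    refine hD'.antisymm fun x hx ↦ ?_
    obtain ⟨i, -, rfl⟩ := Finset.mem_image.1 hx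
    refine fin_mem_of_add_one_mem (T := {i | e i ∈ D'}) ?_ ?_ i
    · obtain ⟨y, hy⟩ := hne
      obtain ⟨i, -, rfl⟩ := Finset.mem_image.1 (hD' hy)
      exact ⟨i, hy⟩
    · intro j hj
      rw [hT, Finset.sum_image he.injOn] at hsum
      simp_rw [fun i ↦ (hlink i).incVec_eq, Finset.sum_add_distrib] at hsum
      have := congrFun hsum (v (j + 1))
      by_contra hj'
      simp only [Set.mem_ofPred_eq] at hj hj'
      simp [Pi.single_apply, hv.eq_iff, Finset.sum_apply, hj, hj'] at this

/-- It is enough that consecutive edges differ. If steps `a < b` used the same edge, then either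
their starting vertices would agree, or the edge would be traversed backwards, which forces `b = a +
1`. -/
lemma isCycleEdgeSet_of_walk {v : ℕ → V} {e : ℕ → α} {i j : ℕ} (hij : i < j)
    (hlink : ∀ n, G.IsLink (e n) (v n) (v (n + 1))) (hne : ∀ n, e n ≠ e (n + 1))
    (hv : Set.InjOn v (Set.Iio j)) (h : v i = v j) : G.IsCycleEdgeSet (e '' Set.Ico i j) := by
  obtain ⟨p, rfl⟩ : ∃ p, j = i + (p + 1) := ⟨j - i - 1, by omega⟩
  have hedge : ∀ a b, a < b → b < i + (p + 1) → e a ≠ e b := by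
    intro a b hab hb heq
    have hl := hlink a
    rw [heq] at hl
    obtain ⟨h1, -⟩ | ⟨-, h2⟩ := hl.eq_and_eq_or_eq_and_eq (hlink b)
    · have := hv (by simp only [Set.mem_Iio]; omega) (by simp only [Set.mem_Iio]; omega) h1
      omega
    · have := hv (by simp only [Set.mem_Iio]; omega) (by simp only [Set.mem_Iio]; omega) h2
      subst this
      exact hne a heq
  refine ⟨p, fun t ↦ v (i + t), fun t ↦ e (i + t), ?_, ?_, ?_, ?_⟩
  · intro a b hab
    have := hv (by simp only [Set.mem_Iio]; omega) (by simp only [Set.mem_Iio]; omega) hab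
    exact Fin.ext (by omega)
  · intro a b hab
    rcases lt_trichotomy a b with hlt | rfl | hlt
    · exact absurd hab (hedge _ _ (by simpa using hlt) (by omega))
    · rfl
    · exact absurd hab.symm (hedge _ _ (by simpa using hlt) (by omega))
  · intro t
    have hl := hlink (i + t)
    rcases Fin.eq_castSucc_or_eq_last t with ⟨s, rfl⟩ | rfl
    · simpa [Fin.val_add_one, add_assoc] using hl
    · simpa [h, add_assoc] using hl
  · ext x
    simp only [Set.mem_image, Set.mem_Ico, Set.mem_range]
    constructor
    · rintro ⟨a, ha, rfl⟩
      exact ⟨⟨a - i, by omega⟩, by simp only []; congr 1; omega⟩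
    · rintro ⟨t, rfl⟩
      exact ⟨i + t, by omega, rfl⟩

/-- In the absence of loops, a walk in `D` can always leave a vertex by an edge other than the one
it came by, since the degree is even. By finiteness of `V` it revisits a vertex, and the first
return closes a cycle. -/
lemma IsEvenSet.exists_isCycleEdgeSet [Finite V] (hD : G.IsEvenSet D) :
    ∃ C : Set α, C ⊆ D ∧ G.IsCycleEdgeSet C := by
  classical
  obtain ⟨⟨e₀, he₀⟩, hsub, hsum⟩ := hD
  by_cases hloop : ∃ e ∈ D, ∃ u, G.IsLink e u u
  · obtain ⟨e, he, u, hu⟩ := hloop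
    refine ⟨{e}, by simpa using he, 0, fun _ ↦ u, fun _ ↦ e, ?_, ?_, fun _ ↦ hu, by simp⟩ <;>
    exact fun i j _ ↦ Fin.ext (by omega)
  push Not at hloop
  -- A state of the walk is an edge of `D` together with the vertex at which it arrives.
  have hnext : ∀ d : {d : α × V // d.1 ∈ D ∧ ∃ u, G.IsLink d.1 u d.2},
      ∃ d' : {d : α × V // d.1 ∈ D ∧ ∃ u, G.IsLink d.1 u d.2},
        d.1.1 ≠ d'.1.1 ∧ G.IsLink d'.1.1 d.1.2 d'.1.2 := by
    rintro ⟨⟨e, w⟩, he, u, hu⟩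
    have hw := congrFun hsum w
    rw [← Finset.add_sum_erase _ _ he] at hw
    have huw : u ≠ w := by
      rintro rfl
      exact hloop e he _ hu
    have h1 : G.incVec e w = 1 := by simp [hu.incVec_eq, huw.symm]
    have hex : ∃ e' ∈ D.erase e, G.incVec e' w ≠ 0 := by
      by_contra! hcon
      rw [Pi.add_apply, Finset.sum_apply, Finset.sum_eq_zero hcon, h1] at hw
      simp at hw
    obtain ⟨e', he', hne⟩ := hex
    obtain ⟨hne', he'D⟩ := Finset.mem_erase.1 he'
    obtain ⟨a, b, hab⟩ := G.exists_isLink_of_mem_edgeSet (hsub he'D)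
    have : w = a ∨ w = b := by
      by_contra! hcon
      simp [hab.incVec_eq, hcon.1, hcon.2] at hne
    rcases this with rfl | rfl
    · exact ⟨⟨(e', b), he'D, w, hab⟩, hne'.symm, hab⟩
    · exact ⟨⟨(e', a), he'D, w, hab.symm⟩, hne'.symm, hab.symm⟩
  choose next hne hlink using hnext
  obtain ⟨a, b, hab⟩ := G.exists_isLink_of_mem_edgeSet (hsub he₀)
  let d : ℕ → {d : α × V // d.1 ∈ D ∧ ∃ u, G.IsLink d.1 u d.2} :=
    fun n ↦ next^[n] ⟨(e₀, b), he₀, a, hab⟩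
  have hd : ∀ n, d (n + 1) = next (d n) := fun n ↦ Function.iterate_succ_apply' _ _ _
  have hrep : ∃ j, ∃ i < j, (d i).1.2 = (d j).1.2 := by
    obtain ⟨x, y, hxy, h⟩ := Finite.exists_ne_map_eq_of_infinite (fun n ↦ (d n).1.2)
    rcases hxy.lt_or_gt with hlt | hlt
    · exact ⟨y, x, hlt, h⟩
    · exact ⟨x, y, hlt, h.symm⟩
  obtain ⟨i, hij, hv⟩ := Nat.find_spec hrep
  -- The edge from the `n`-th vertex to the next is stored in the state `d (n + 1)`, whence the
  -- shift. Minimality of the index from `Nat.find` makes the earlier vertices distinct.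
  refine ⟨_, ?_, isCycleEdgeSet_of_walk (v := fun n ↦ (d n).1.2) (e := fun n ↦ (d (n + 1)).1.1)
    hij ?_ ?_ ?_ hv⟩
  · rintro _ ⟨n, -, rfl⟩
    exact (d (n + 1)).2.1
  · intro n
    simp only [hd]
    exact hlink _
  · intro n
    simp only [hd (n + 1)]
    exact hne _
  · intro x hx y hy hxy
    by_contra hne
    rcases Ne.lt_or_gt hne with hlt | hlt
    · exact Nat.find_min hrep hy ⟨x, hlt, hxy⟩
    · exact Nat.find_min hrep hx ⟨y, hlt, hxy.symm⟩

/-- The graph with edge set `E` in which `e` joins `a e` to `b e`. -/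
def ofEnds (E : Set α) (a b : α → V) : Graph V α where
  vertexSet := Set.univ
  IsLink e u w := e ∈ E ∧ (u = a e ∧ w = b e ∨ u = b e ∧ w = a e)
  edgeSet := E
  isLink_symm := by
    exact fun e he ↦ ⟨fun u w ⟨h, h'⟩ ↦ ⟨h, by tauto⟩⟩
  eq_or_eq_of_isLink_of_isLink := by
    rintro e x y z w ⟨-, h⟩ ⟨-, h'⟩
    rcases h with ⟨rfl, rfl⟩ | ⟨rfl, rfl⟩ <;> rcases h' with ⟨rfl, rfl⟩ | ⟨rfl, rfl⟩ <;> simp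
  edge_mem_iff_exists_isLink e := ⟨fun h ↦ ⟨_, _, h, Or.inl ⟨rfl, rfl⟩⟩, fun ⟨_, _, h, _⟩ ↦ h⟩
  left_mem_of_isLink := by simp

lemma ofEnds_isLink {E : Set α} {a b : α → V} (he : e ∈ E) :
    (ofEnds E a b).IsLink e (a e) (b e) := ⟨he, Or.inl ⟨rfl, rfl⟩⟩

end Graph

/-! ### Binary and Schubert matroids lack the two minors. -/

namespace Matroid

variable {α β W : Type*} {M : Matroid α} {N : Matroid β} [AddCommGroup W]

/-- Coefficients are 0 or 1, so a linear relation is just its support. -/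
lemma linearIndepOn_zmod_two_iff [Module (ZMod 2) W] {x : α → W} {I : Set α} :
    LinearIndepOn (ZMod 2) x I ↔
      ∀ D : Finset α, (D : Set α) ⊆ I → ∑ e ∈ D, x e = 0 → D = ∅ := by
  classical
  rw [linearIndepOn_iff'']
  constructor
  · intro h D hD hsum
    by_contra hne
    obtain ⟨c, hc⟩ := Finset.nonempty_iff_ne_empty.2 hne
    have := h D (fun e ↦ if e ∈ D then 1 else 0) hD (fun e he ↦ by simp [he])
      (by simpa [ite_smul] using hsum) c
    simp [hc] at this
  · intro h D g hD hg hsum e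
    have hzero : D.filter (fun e ↦ g e ≠ 0) = ∅ := by
      refine h _ (fun e he ↦ hD (Finset.mem_filter.1 he).1) ?_
      rw [← hsum, Finset.sum_filter]
      refine Finset.sum_congr rfl fun e _ ↦ ?_
      have h2 : ∀ y : ZMod 2, y = 0 ∨ y = 1 := by decide
      rcases h2 (g e) with h0 | h1
      · simp [h0]
      · simp [h1]
    intro he
    by_contra hne
    have : e ∈ D.filter (fun e ↦ g e ≠ 0) := Finset.mem_filter.2 ⟨he, hne⟩
    simp [hzero] at this

/-- The independent sets of `M` are the subsets of its ground set without nonempty finite subsets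
on which `x` sums to zero. -/
def HasZeroSumVectors (M : Matroid α) (x : α → W) : Prop :=
  ∀ I ⊆ M.E, M.Indep I ↔ ∀ D : Finset α, (D : Set α) ⊆ I → ∑ e ∈ D, x e = 0 → D = ∅

lemma IsBinary.exists_hasZeroSumVectors (h : M.IsBinary) :
    ∃ (r : ℕ) (x : α → Fin r → ZMod 2), M.HasZeroSumVectors x := by
  obtain ⟨r, x, hx⟩ := h
  exact ⟨r, x, fun I hI ↦ by rw [hx I hI, linearIndepOn_zmod_two_iff]⟩

lemma HasZeroSumVectors.isBinary {V : Type*} [Finite V] {x : α → V → ZMod 2}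
    (h : M.HasZeroSumVectors x) : M.IsBinary := by
  obtain ⟨r, ⟨σ⟩⟩ := Finite.exists_equiv_fin V
  refine ⟨r, fun e i ↦ x e (σ.symm i), fun I hI ↦ ?_⟩
  rw [h I hI, linearIndepOn_zmod_two_iff]
  refine forall_congr' fun D ↦ forall_congr' fun _ ↦ ?_
  have : ∑ e ∈ D, x e = 0 ↔ ∑ e ∈ D, (fun i ↦ x e (σ.symm i)) = 0 := by
    simp only [funext_iff, Finset.sum_apply, Pi.zero_apply]
    exact σ.symm.forall_congr_right.symm
  rw [this]

section

variable {x : α → W} {C : Set α} {D : Finset α} {c : α}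

lemma HasZeroSumVectors.sum_eq_zero_of_isCircuit (h : M.HasZeroSumVectors x)
    (hC : M.IsCircuit C) : ∃ D : Finset α, (D : Set α) = C ∧ ∑ e ∈ D, x e = 0 := by
  have hni := hC.not_indep
  rw [h C hC.subset_ground] at hni
  push Not at hni
  obtain ⟨D, hDC, hsum, hne⟩ := hni
  refine ⟨D, hC.eq_of_not_indep_subset ?_ hDC, hsum⟩
  rw [h _ (hDC.trans hC.subset_ground)]
  exact fun hD ↦ hne.ne_empty (hD D subset_rfl hsum)

/-- A zero-sum set is a disjoint union of circuits: remove zero-sum circuits until one of them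
contains `c`. -/
lemma HasZeroSumVectors.exists_isCircuit_mem (h : M.HasZeroSumVectors x)
    (hDE : (D : Set α) ⊆ M.E) (hsum : ∑ e ∈ D, x e = 0) (hc : c ∈ D) :
    ∃ C, M.IsCircuit C ∧ c ∈ C ∧ C ⊆ D := by
  classical
  induction D using Finset.strongInduction with
  | H D ih =>
    have hdep : M.Dep D := by
      refine ⟨fun hD ↦ ?_, hDE⟩
      rw [(h _ hDE).1 hD D subset_rfl hsum] at hc
      simp at hc
    obtain ⟨C, hCD, hC⟩ := hdep.exists_isCircuit_subset
    obtain ⟨D', rfl, hsum'⟩ := h.sum_eq_zero_of_isCircuit hC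
    by_cases hcD' : c ∈ D'
    · exact ⟨_, hC, hcD', hCD⟩
    have hsub : D' ⊆ D := by exact_mod_cast hCD
    obtain ⟨C, hC', hcC, hCD'⟩ := ih (D \ D')
      (Finset.sdiff_ssubset hsub (by simpa using hC.nonempty))
      (fun e he ↦ hDE (Finset.sdiff_subset he))
      (by rw [← Finset.sum_sdiff hsub, hsum', add_zero] at hsum; exact hsum)
      (Finset.mem_sdiff.2 ⟨hc, hcD'⟩)
    exact ⟨C, hC', hcC, fun e he ↦ Finset.sdiff_subset (hCD' he)⟩

end

/-- As `N` occupies its whole type, an isomorphism becomes a plain function, free of subtypes. -/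
lemma isIsomorphicTo_iff_exists_injective (hN : N.E = Set.univ) :
    M.IsIsomorphicTo N ↔ ∃ g : β → α, Function.Injective g ∧ Set.range g = M.E ∧
      ∀ J, M.Indep (g '' J) ↔ N.Indep J := by
  constructor
  · rintro ⟨e, he⟩
    let s : β ≃ N.E := ((Equiv.setCongr hN).trans (Equiv.Set.univ β)).symm
    have hs : ∀ b, (s b : β) = b := fun _ ↦ rfl
    refine ⟨fun b ↦ e.symm (s b),
      Subtype.val_injective.comp (e.symm.injective.comp s.injective), ?_, fun J ↦ ?_⟩
    · ext a
      constructor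
      · rintro ⟨b, rfl⟩
        exact (e.symm (s b)).2
      · intro ha
        exact ⟨s.symm (e ⟨a, ha⟩), by simp⟩
    · have := he (e.symm '' (s '' J))
      simp only [Set.image_image, Equiv.apply_symm_apply, hs, Set.image_id'] at this
      exact this
  · rintro ⟨g, hg, hr, hJ⟩
    let t : β ≃ M.E := (Equiv.ofInjective g hg).trans (Equiv.setCongr hr)
    have ht : ∀ b, (t b : α) = g b := fun _ ↦ rfl
    let s : N.E ≃ β := (Equiv.setCongr hN).trans (Equiv.Set.univ β)
    refine ⟨(s.trans t).symm, fun I ↦ ?_⟩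
    rw [← hJ]
    have hval : ∀ y : M.E, g ((s.trans t).symm y) = y := by
      intro y
      have : t (s ((s.trans t).symm y)) = y := (s.trans t).apply_symm_apply y
      exact congrArg Subtype.val this
    simp only [Set.image_image, hval]

lemma isCircuit_image {g : β → α} (hg : Set.range g = M.E)
    (hJ : ∀ J, M.Indep (g '' J) ↔ N.Indep J) {J : Set β}
    (hC : N.IsCircuit J) : M.IsCircuit (g '' J) := by
  rw [isCircuit_iff_forall_ssubset]
  refine ⟨⟨by rw [hJ]; exact hC.not_indep, hg ▸ Set.image_subset_range _ _⟩, fun I hI ↦ ?_⟩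
  obtain ⟨K, hK, rfl⟩ := Set.subset_image_iff.1 hI.subset
  rw [hJ]
  refine hC.ssubset_indep (hK.ssubset_of_ne ?_)
  rintro rfl
  exact hI.ne rfl

lemma uniformMatroid_isCircuit {k n : ℕ} {J : Set (Fin n)} (hJ : J.ncard = k + 1) :
    (uniformMatroid k n).IsCircuit J := by
  rw [isCircuit_iff_forall_ssubset]
  refine ⟨⟨by simp [hJ], by simp⟩, fun I hI ↦ ?_⟩
  have := Set.ncard_lt_ncard hI (Set.toFinite _)
  simp only [uniformMatroid_indep_iff]
  omega

lemma IsIsomorphicTo.exists_isCircuit_of_uniformMatroid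
    (h : M.IsIsomorphicTo (uniformMatroid 2 4)) :
    ∃ a b c d, c ≠ a ∧ c ≠ b ∧ c ≠ d ∧ M.IsCircuit {a, b, c} ∧ M.IsCircuit {a, b, d} ∧
      M.Indep {c, d} := by
  obtain ⟨g, hg, hr, hJ⟩ := (isIsomorphicTo_iff_exists_injective rfl).1 h
  have hcirc : ∀ i j k : Fin 4, i ≠ j → i ≠ k → j ≠ k → M.IsCircuit {g i, g j, g k} := by
    intro i j k hij hik hjk
    have := isCircuit_image hr hJ
      (uniformMatroid_isCircuit (k := 2) (J := {i, j, k}) (Set.ncard_eq_three.2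
        ⟨i, j, k, hij, hik, hjk, rfl⟩))
    simpa [Set.image_insert_eq] using this
  refine ⟨g 0, g 1, g 2, g 3, hg.ne (by decide), hg.ne (by decide), hg.ne (by decide),
    hcirc _ _ _ (by decide) (by decide) (by decide),
    hcirc _ _ _ (by decide) (by decide) (by decide), ?_⟩
  have := (hJ {2, 3}).2 (by simp)
  simpa [Set.image_insert_eq] using this

lemma IsIsomorphicTo.exists_isCircuit_of_sum
    (h : M.IsIsomorphicTo ((uniformMatroid 1 2).sum (uniformMatroid 1 2))) :
    ∃ a b c d, a ≠ c ∧ M.IsCircuit {a, b} ∧ M.IsCircuit {c, d} ∧ M.Indep {a, c} := by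
  have hE : ((uniformMatroid 1 2).sum (uniformMatroid 1 2)).E = Set.univ := by
    ext (i | i) <;> simp
  obtain ⟨g, hg, hr, hJ⟩ := (isIsomorphicTo_iff_exists_injective hE).1 h
  have hJ' : ∀ J : Set (Fin 2 ⊕ Fin 2),
      M.Indep (g '' J) ↔ (Sum.inl ⁻¹' J).ncard ≤ 1 ∧ (Sum.inr ⁻¹' J).ncard ≤ 1 := by
    intro J
    simp [hJ]
  have h2 : ∀ S : Set (Fin 2), S.ncard ≤ 1 ↔ S.Subsingleton := fun S ↦
    Set.ncard_le_one_iff_subsingleton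
  simp only [h2] at hJ'
  have hcirc : ∀ u w, M.Indep {g u} → M.Indep {g w} → ¬ M.Indep {g u, g w} →
      M.IsCircuit {g u, g w} := by
    intro u w hu hw huw
    rw [isCircuit_iff_dep_forall_sdiff_singleton_indep]
    refine ⟨⟨huw, by rw [← hr]; rintro _ (rfl | rfl) <;> simp⟩, ?_⟩
    rintro e (rfl | rfl)
    · exact hw.subset (by simp)
    · exact hu.subset (by rintro x ⟨rfl | rfl, h'⟩ <;> simp_all)
  have hsing : ∀ u, M.Indep {g u} := by
    intro u
    rw [← Set.image_singleton, hJ']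
    rcases u with i | i <;> simp [Set.Subsingleton]
  refine ⟨g (.inl 0), g (.inl 1), g (.inr 0), g (.inr 1), hg.ne (by simp),
    hcirc _ _ (hsing _) (hsing _) ?_, hcirc _ _ (hsing _) (hsing _) ?_, ?_⟩
  · rw [← Set.image_pair, hJ']
    simp [Set.Subsingleton]
  · rw [← Set.image_pair, hJ']
    simp [Set.Subsingleton]
  · rw [← Set.image_pair, hJ']
    simp [Set.Subsingleton]

/-- The rest of `X` spans `c` and lies in `{d} ∪ C`, so after contracting `C` the element `c` is
spanned by `d`. -/
lemma not_indep_contract_of_isCircuit {C D X : Set α} {c d : α} (hX : M.IsCircuit X) (hcd : c ≠ d)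
    (hcX : c ∈ X) (hXC : X ⊆ insert c (insert d C)) : ¬ (M ／ C ＼ D).Indep {c, d} := by
  intro hind
  have hind' := hind.of_delete
  have hdj : Disjoint {c, d} C := (Set.subset_sdiff.1 hind'.subset_ground).2
  have hcl : c ∈ (M ／ C).closure {d} := by
    rw [contract_closure_eq]
    refine ⟨?_, fun hc ↦ hdj.le_bot ⟨by simp, hc⟩⟩
    refine M.closure_subset_closure ?_ (hX.mem_closure_sdiff_singleton_of_mem hcX)
    rintro y ⟨hy, hyc⟩
    rcases hXC hy with rfl | rfl | hy
    · simp at hyc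
    · simp
    · exact Or.inr hy
  have := hind'.notMem_closure_sdiff_of_mem (e := c) (by simp)
  rw [Set.insert_sdiff_of_mem _ (by simp), Set.sdiff_singleton_eq_self (by simpa using hcd)] at this
  exact this hcl

/-- Lift the triangles `{a, b, c}` and `{a, b, d}` of the minor to circuits of `M` by adding
elements of `C`. In their symmetric difference `a` and `b` cancel and `c` survives, so some circuit
through `c` lies in `{c, d} ∪ C`. This makes `{c, d}` dependent in the minor. -/
theorem IsBinary.not_hasMinorIsoTo_uniformMatroid (h : M.IsBinary) :
    ¬ M.HasMinorIsoTo (uniformMatroid 2 4) := by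
  classical
  rintro ⟨_, ⟨C, D, rfl⟩, hiso⟩
  obtain ⟨r, x, hx⟩ := h.exists_hasZeroSumVectors
  obtain ⟨a, b, c, d, hca, hcb, hcd, habc, habd, hind⟩ := hiso.exists_isCircuit_of_uniformMatroid
  have hdj : Disjoint {a, b, c} C := (Set.subset_sdiff.1 habc.of_delete.subset_ground).2
  obtain ⟨X, hX, hX1, hX2⟩ := habc.of_delete.exists_subset_isCircuit_of_contract
  obtain ⟨Y, hY, hY1, hY2⟩ := habd.of_delete.exists_subset_isCircuit_of_contract
  obtain ⟨DX, rfl, hsX⟩ := hx.sum_eq_zero_of_isCircuit hX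
  obtain ⟨DY, rfl, hsY⟩ := hx.sum_eq_zero_of_isCircuit hY
  simp only [Set.insert_subset_iff, Set.singleton_subset_iff, Finset.mem_coe] at hX1 hY1
  have hcY : c ∉ DY := by
    intro hc
    rcases hY2 hc with (h | h | h) | h
    · exact hca h
    · exact hcb h
    · exact hcd h
    · exact hdj.le_bot ⟨by simp, h⟩
  have hsum : ∑ e ∈ symmDiff DX DY, x e = 0 := by
    have h1 := Finset.sum_inter_add_sum_sdiff DX DY x
    have h2 := Finset.sum_inter_add_sum_sdiff DY DX x
    rw [hsX] at h1
    rw [hsY, Finset.inter_comm] at h2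
    rw [symmDiff, Finset.sup_eq_union, Finset.sum_union disjoint_sdiff_sdiff]
    have h3 : ∀ u v w : Fin r → ZMod 2, u + v = 0 → u + w = 0 → v + w = 0 := by
      intro u v w hv hw
      rw [add_left_cancel (hv.trans hw.symm)]
      exact funext fun _ ↦ CharTwo.add_self_eq_zero _
    exact h3 _ _ _ h1 h2
  obtain ⟨K, hK, hcK, hKD⟩ := hx.exists_isCircuit_mem (c := c) (D := symmDiff DX DY)
    (by
      intro e he
      rcases Finset.mem_symmDiff.1 he with h | h
      · exact hX.subset_ground h.1
      · exact hY.subset_ground h.1) hsum (Finset.mem_symmDiff.2 (Or.inl ⟨hX1.2.2, hcY⟩))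
  refine not_indep_contract_of_isCircuit hK hcd hcK (fun y hy ↦ ?_) hind
  rcases Finset.mem_symmDiff.1 (hKD hy) with ⟨h, h'⟩ | ⟨h, h'⟩
  · rcases hX2 h with (rfl | rfl | rfl) | hC
    · exact absurd hY1.1 h'
    · exact absurd hY1.2.1 h'
    · simp
    · simp [hC]
  · rcases hY2 h with (rfl | rfl | rfl) | hC
    · exact absurd hX1.1 h'
    · exact absurd hX1.2.1 h'
    · simp
    · simp [hC]

lemma IsCircuit.isCyclicFlat_closure {C : Set α} (hC : M.IsCircuit C) :
    M.IsCyclicFlat (M.closure C) := by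
  refine ⟨M.isFlat_closure C, {X | M.IsCircuit X ∧ X ⊆ M.closure C}, fun X hX ↦ hX.1, ?_⟩
  refine Set.Subset.antisymm (fun e he ↦ ?_) (Set.sUnion_subset fun X hX ↦ hX.2)
  by_cases heC : e ∈ C
  · exact ⟨C, ⟨hC, M.subset_closure C hC.subset_ground⟩, heC⟩
  · obtain ⟨X, hXC, hX, heX⟩ := (mem_closure_iff_exists_isCircuit heC).1 he
    exact ⟨X, ⟨hX, hXC.trans (Set.insert_subset he (M.subset_closure C hC.subset_ground))⟩, heX⟩

/-- Lift the two parallel pairs to circuits `X` and `Y` of `M`. Their closures are cyclic flats,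
hence comparable, and an inclusion puts an element of one pair into the span of the other pair in
the minor. -/
theorem IsSchubert.not_hasMinorIsoTo_sum (h : M.IsSchubert) :
    ¬ M.HasMinorIsoTo ((uniformMatroid 1 2).sum (uniformMatroid 1 2)) := by
  rintro ⟨_, ⟨C, D, rfl⟩, hiso⟩
  obtain ⟨a, b, c, d, hac, hab, hcd, hind⟩ := hiso.exists_isCircuit_of_sum
  have key : ∀ {a b c d}, a ≠ c → (M ／ C ＼ D).IsCircuit {a, b} → (M ／ C ＼ D).IsCircuit {c, d} →
      ∀ X Y, M.IsCircuit X → M.IsCircuit Y → {a, b} ⊆ X → Y ⊆ {c, d} ∪ C →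
      M.closure X ⊆ M.closure Y → ¬ (M ／ C ＼ D).Indep {a, c} := by
    intro a b c d hac hab hcd X Y hX hY hX1 hY2 hXY hind
    have hind' := hind.of_delete
    have hdj : Disjoint {a, c} C := (Set.subset_sdiff.1 hind'.subset_ground).2
    have hacl : a ∈ (M ／ C).closure {c} := by
      have hd : (M ／ C).closure {c, d} = (M ／ C).closure {c} := by
        have h1 := hcd.of_delete.closure_sdiff_singleton_eq d
        refine (h1.symm.trans_subset ((M ／ C).closure_subset_closure ?_)).antisymm
          ((M ／ C).closure_subset_closure (by simp))
        rintro x ⟨rfl | rfl, h⟩ <;> simp_all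
      rw [← hd, contract_closure_eq]
      exact ⟨M.closure_subset_closure hY2 (hXY (M.subset_closure X hX.subset_ground (hX1 (by simp)))),
        fun h ↦ hdj.le_bot ⟨by simp, h⟩⟩
    have := hind'.notMem_closure_sdiff_of_mem (e := a) (by simp)
    rw [Set.insert_sdiff_of_mem _ (by simp), Set.sdiff_singleton_eq_self (by simpa using hac)] at this
    exact this hacl
  obtain ⟨X, hX, hX1, hX2⟩ := hab.of_delete.exists_subset_isCircuit_of_contract
  obtain ⟨Y, hY, hY1, hY2⟩ := hcd.of_delete.exists_subset_isCircuit_of_contract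
  rcases h.total hX.isCyclicFlat_closure hY.isCyclicFlat_closure with hXY | hYX
  · exact key hac hab hcd X Y hX hY hX1 hY2 hXY hind
  · exact key hac.symm hcd hab Y X hY hX hY1 hX2 hYX (Set.pair_comm a c ▸ hind)

end Matroid

/-! ### From the excluded minors to the partition. -/

namespace Matroid

variable {α : Type*} {M : Matroid α} {B C X Y Z : Set α} {b c f g s u w x : α}

/-- The set `E` of elements splits into loops `L`, coloops `K`, a set `P` of parallel elements and
a set `S` such that `S ∪ {p}` is a circuit for all `p ∈ P`. -/
structure IsMinimalPartition (M : Matroid α) (L S P K : Set α) : Prop where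
  union_eq : L ∪ (S ∪ (P ∪ K)) = M.E
  disjoint_left : Disjoint L (S ∪ (P ∪ K))
  disjoint_middle : Disjoint S (P ∪ K)
  disjoint_right : Disjoint P K
  indep_iff : ∀ I ⊆ M.E, M.Indep I ↔
    Disjoint I L ∧ (I ∩ P).Subsingleton ∧ ¬ (S ⊆ I ∧ (I ∩ P).Nonempty)

lemma hasMinorIsoTo_of_restrict {β : Type*} {N : Matroid β} (hN : N.E = Set.univ) (Z : Set α)
    {g : β → α} (hinj : Function.Injective g) (hE : Set.range g ⊆ (M ／ Z).E)
    (hg : ∀ J, (M ／ Z).Indep (g '' J) ↔ N.Indep J) : M.HasMinorIsoTo N := by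
  refine ⟨M ／ Z ＼ ((M ／ Z).E \ Set.range g), contract_delete_isMinor _ _ _, ?_⟩
  rw [delete_compl hE, isIsomorphicTo_iff_exists_injective hN]
  exact ⟨g, hinj, rfl, fun J ↦ by simp [hg]⟩

lemma hasMinorIsoTo_uniformMatroid (Z : Set α) {g : Fin 4 → α} (hinj : Function.Injective g)
    (hpair : ∀ i j, i < j → (M ／ Z).Indep {g i, g j})
    (hcl : ∀ i, g i ∈ (M ／ Z).closure {g 0, g 1}) : M.HasMinorIsoTo (uniformMatroid 2 4) := by
  classical
  refine hasMinorIsoTo_of_restrict rfl Z hinj ?_ fun J ↦ ?_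
  · rintro _ ⟨i, rfl⟩
    exact mem_ground_of_mem_closure (hcl i)
  rw [uniformMatroid_indep_iff]
  constructor
  · intro h
    have h1 := h.encard_le_eRk_of_subset (X := (M ／ Z).closure {g 0, g 1})
      (by rintro _ ⟨i, -, rfl⟩; exact hcl i)
    rw [eRk_closure_eq, hinj.encard_image] at h1
    have h2 := (h1.trans (eRk_le_encard _ _)).trans (Set.encard_insert_le _ _)
    rw [Set.encard_singleton, ← Set.Finite.cast_ncard_eq (Set.toFinite J)] at h2
    exact_mod_cast h2
  · intro h
    have hex : ∀ J : Finset (Fin 4), J.card ≤ 2 → ∃ i j, i < j ∧ J ⊆ {i, j} := by decide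
    obtain ⟨i, j, hij, hJ⟩ := hex J.toFinset (by rwa [Set.ncard_eq_toFinset_card'] at h)
    refine (hpair i j hij).subset ?_
    rw [← Set.image_pair]
    refine Set.image_mono fun k hk ↦ ?_
    simpa using hJ (Set.mem_toFinset.2 hk)

/-- Distinctness need not be assumed: any coincidence among the four elements would make `{a 0, a
1}` or `{d 0, d 1}` part of an independent pair `{a i, d j}`. -/
lemma hasMinorIsoTo_sum (Z : Set α) {a d : Fin 2 → α}
    (had : ∀ i j, (M ／ Z).Indep {a i, d j}) (ha : ¬ (M ／ Z).Indep {a 0, a 1})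
    (hd : ¬ (M ／ Z).Indep {d 0, d 1}) :
    M.HasMinorIsoTo ((uniformMatroid 1 2).sum (uniformMatroid 1 2)) := by
  have ha' : Function.Injective a := by
    have : a 0 ≠ a 1 := fun h ↦ ha ((had 0 0).subset (by simp [h]))
    intro i j
    fin_cases i <;> fin_cases j <;> simp [this, this.symm]
  have hd' : Function.Injective d := by
    have : d 0 ≠ d 1 := fun h ↦ hd ((had 0 0).subset (by simp [h]))
    intro i j
    fin_cases i <;> fin_cases j <;> simp [this, this.symm]
  have hne : ∀ i j, a i ≠ d j := by
    have : ∀ i j, a i = d j → (M ／ Z).Indep {a 0, a 1} := by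
      intro i j hij
      rcases Fin.exists_fin_two.1 ⟨i, rfl⟩ with rfl | rfl
      · exact Set.pair_comm (a 1) (a 0) ▸ hij ▸ had 1 j
      · exact hij ▸ had 0 j
    exact fun i j hij ↦ ha (this i j hij)
  have hE : ((uniformMatroid 1 2).sum (uniformMatroid 1 2)).E = Set.univ := by
    ext (i | i) <;> simp
  have hsub : ∀ S : Set (Fin 2), S.ncard ≤ 1 ↔ ∃ i, S ⊆ {i} := by
    intro S
    rw [Set.ncard_le_one_iff_subsingleton]
    constructor
    · intro h
      rcases h.eq_empty_or_singleton with rfl | ⟨i, rfl⟩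
      · exact ⟨0, by simp⟩
      · exact ⟨i, subset_rfl⟩
    · rintro ⟨i, h⟩
      exact Set.subsingleton_singleton.anti h
  refine hasMinorIsoTo_of_restrict hE Z (g := Sum.elim a d)
    (Function.Injective.sumElim ha' hd' hne) ?_ fun J ↦ ?_
  · rintro _ ⟨i | i, rfl⟩
    · exact (had i 0).subset_ground (by simp)
    · exact (had 0 i).subset_ground (by simp)
  simp only [sum_indep_iff, uniformMatroid_indep_iff]
  constructor
  · intro h
    rw [Set.ncard_le_one_iff_subsingleton, Set.ncard_le_one_iff_subsingleton]
    constructor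
    · intro i hi j hj
      by_contra hij
      refine ha (h.subset ?_)
      have : ∀ k : Fin 2, a k ∈ Sum.elim a d '' J := by
        intro k
        have : k = i ∨ k = j := by omega
        rcases this with rfl | rfl
        · exact ⟨.inl _, hi, rfl⟩
        · exact ⟨.inl _, hj, rfl⟩
      rintro _ (rfl | rfl) <;> exact this _
    · intro i hi j hj
      by_contra hij
      refine hd (h.subset ?_)
      have : ∀ k : Fin 2, d k ∈ Sum.elim a d '' J := by
        intro k
        have : k = i ∨ k = j := by omega
        rcases this with rfl | rfl
        · exact ⟨.inr _, hi, rfl⟩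
        · exact ⟨.inr _, hj, rfl⟩
      rintro _ (rfl | rfl) <;> exact this _
  · rintro ⟨h1, h2⟩
    obtain ⟨i, hi⟩ := (hsub _).1 h1
    obtain ⟨j, hj⟩ := (hsub _).1 h2
    refine (had i j).subset ?_
    rintro _ ⟨k | k, hk, rfl⟩
    · exact Or.inl (congrArg a (hi hk))
    · exact Or.inr (congrArg d (hj hk))

lemma IsCircuit.indep_insert_sdiff {I : Set α} (hY : M.IsCircuit Y) (hI : M.Indep I)
    (hx : x ∉ I) (hYI : Y ⊆ insert x I) (hw : w ∈ Y) :
    M.Indep (insert x I \ {w}) := by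
  have hxY : x ∈ Y := by
    by_contra hxY
    exact hY.not_indep (hI.subset fun y hy ↦ (hYI hy).resolve_left (by rintro rfl; exact hxY hy))
  have hxcl : x ∈ M.closure I := by
    refine M.closure_subset_closure ?_ (hY.mem_closure_sdiff_singleton_of_mem hxY)
    rintro y ⟨hy, hyx⟩
    exact (hYI hy).resolve_left hyx
  rw [hY.eq_fundCircuit_of_subset hI hYI] at hw
  exact (hI.mem_fundCircuit_iff hxcl hx).1 hw

lemma Indep.insert_of_parallel {I : Set α} (h : M.Indep (insert c I)) (hc : c ∉ I)
    (hcx : c ∈ M.closure {x}) (hx : x ∈ M.E) : M.Indep (insert x I) := by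
  have hI : M.Indep I := h.subset (Set.subset_insert _ _)
  by_cases hxI : x ∈ I
  · rwa [Set.insert_eq_of_mem hxI]
  refine (hI.insert_indep_iff_of_notMem hxI).2 ⟨hx, fun hcl ↦ ?_⟩
  have h1 := h.notMem_closure_sdiff_of_mem (Set.mem_insert c I)
  rw [Set.insert_sdiff_self_of_notMem hc] at h1
  exact h1 (M.closure_subset_closure_of_subset_closure (Set.singleton_subset_iff.2 hcl) hcx)

/-- If `s` lies only in the circuit of `f` and `b` only in that of `g`, contracting `B \ {s, b}`
leaves the parallel pairs `{s, f}` and `{b, g}`, which form the forbidden direct sum. Hence the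
traces on `B` are nested. -/
lemma fundCircuit_comparable
    (h₂ : ¬ M.HasMinorIsoTo ((uniformMatroid 1 2).sum (uniformMatroid 1 2)))
    (hB : M.IsBase B) (hf : f ∈ M.E \ B) (hg : g ∈ M.E \ B) (hs : s ∈ B) (hb : b ∈ B)
    (hsf : s ∈ M.fundCircuit f B) (hsg : s ∉ M.fundCircuit g B)
    (hbg : b ∈ M.fundCircuit g B) : b ∈ M.fundCircuit f B := by
  by_contra hbf
  have hX := hB.fundCircuit_isCircuit hf.1 hf.2
  have hY := hB.fundCircuit_isCircuit hg.1 hg.2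
  have hXs := M.fundCircuit_subset_insert f B
  have hYs := M.fundCircuit_subset_insert g B
  set X := M.fundCircuit f B
  set Y := M.fundCircuit g B
  have hfg : f ≠ g := by
    rintro rfl
    exact hsg hsf
  have hsb : s ≠ b := by
    rintro rfl
    exact hbf hsf
  have hfB := hf.2
  have hgB := hg.2
  have hZ : M.Indep (B \ {s, b}) := hB.indep.subset Set.sdiff_subset
  have hfs : f ≠ s := by rintro rfl; exact hfB hs
  have hfb : f ≠ b := by rintro rfl; exact hfB hb
  have hgs : g ≠ s := by rintro rfl; exact hgB hs
  have hgb : g ≠ b := by rintro rfl; exact hgB hb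
  have hgi : M.Indep (insert g B \ {b}) := hY.indep_insert_sdiff hB.indep hgB hYs hbg
  have hfi : M.Indep (insert f B \ {s}) := hX.indep_insert_sdiff hB.indep hfB hXs hsf
  have hfgi : M.Indep (insert f (insert g B \ {b}) \ {s}) :=
    hX.indep_insert_sdiff hgi (by simp [hfg, hfB]) (by
      intro y hy
      have h := hXs hy
      have hyb : y ≠ b := by rintro rfl; exact hbf hy
      simp only [Set.mem_insert_iff] at h
      simp only [Set.mem_insert_iff, Set.mem_sdiff, Set.mem_singleton_iff]
      tauto) hsf
  refine h₂ (hasMinorIsoTo_sum (B \ {s, b}) (a := ![s, f]) (d := ![b, g]) ?_ ?_ ?_)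
  · intro i j
    rw [hZ.contract_indep_iff]
    fin_cases i <;> fin_cases j
    · exact ⟨by simp [Set.disjoint_left], hB.indep.subset (by
        intro y; simp; grind)⟩
    · exact ⟨by simp [Set.disjoint_left, hgB], hgi.subset (by
        intro y; simp; grind)⟩
    · exact ⟨by simp [Set.disjoint_left, hfB], hfi.subset (by
        intro y; simp; grind)⟩
    · exact ⟨by simp [Set.disjoint_left, hfB, hgB], hfgi.subset (by
        intro y; simp; grind)⟩
  · rw [hZ.contract_indep_iff]
    rintro ⟨-, hi⟩
    refine hX.not_indep (hi.subset fun y hy ↦ ?_)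
    have := hXs hy
    simp; grind
  · rw [hZ.contract_indep_iff]
    rintro ⟨-, hi⟩
    refine hY.not_indep (hi.subset fun y hy ↦ ?_)
    have := hYs hy
    simp; grind

/-- Each element of `B` that is not a coloop lies in some fundamental circuit. As the traces form a
chain, the largest one contains all these elements. -/
lemma exists_isCircuit_spanning_or_indep [M.Finite]
    (h₂ : ¬ M.HasMinorIsoTo ((uniformMatroid 1 2).sum (uniformMatroid 1 2))) :
    M.E ⊆ M.coloops ∨ ∃ C, M.IsCircuit C ∧ M.E ⊆ M.closure C ∪ M.coloops := by
  obtain ⟨B, hB⟩ := M.exists_isBase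
  have hcol : ∀ b ∈ B, b ∉ M.coloops → ∃ g ∈ M.E \ B, b ∈ M.fundCircuit g B := by
    intro b hb hbc
    by_contra! hcon
    exact hbc ((hB.isColoop_iff_forall_notMem_fundCircuit hb).2 hcon)
  rcases (M.E \ B).eq_empty_or_nonempty with hE | hE
  · left
    intro e he
    by_contra hec
    have heB : e ∈ B := by
      by_contra heB
      exact hE.subset ⟨he, heB⟩
    obtain ⟨g, hg, -⟩ := hcol e heB hec
    exact hE.subset hg
  right
  obtain ⟨f, hf, hmax⟩ := Set.exists_max_image (M.E \ B) (fun f ↦ (M.fundCircuit f B ∩ B).ncard)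
    (M.ground_finite.subset Set.sdiff_subset) hE
  have hBfin : B.Finite := M.ground_finite.subset hB.subset_ground
  have hBsub : B ⊆ M.fundCircuit f B ∪ M.coloops := by
    intro b hb
    by_contra hcon
    rw [Set.mem_union, not_or] at hcon
    obtain ⟨g, hg, hbg⟩ := hcol b hb hcon.2
    have hsub : M.fundCircuit f B ∩ B ⊂ M.fundCircuit g B ∩ B := by
      refine ⟨fun s hs ↦ ⟨?_, hs.2⟩, fun h ↦ hcon.1 (h ⟨hbg, hb⟩).1⟩
      by_contra hsg
      exact hcon.1 (fundCircuit_comparable h₂ hB hf hg hs.2 hb hs.1 hsg hbg)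
    exact (Set.ncard_lt_ncard hsub (hBfin.subset Set.inter_subset_right)).not_ge (hmax g hg)
  refine ⟨_, hB.fundCircuit_isCircuit hf.1 hf.2, ?_⟩
  rw [← closure_union_coloops_eq, ← hB.closure_eq]
  exact M.closure_subset_closure hBsub

lemma subset_insert_sdiff_singleton (hXs : X ⊆ insert x C) (hu : u ∉ X) :
    X ⊆ insert x (C \ {u}) := by
  intro y hy
  rcases hXs hy with rfl | h
  · simp
  · exact Or.inr ⟨h, by rintro rfl; exact hu hy⟩

lemma IsCircuit.indep_insert_sdiff_sdiff (hC : M.IsCircuit C) (hxC : x ∉ C) (hY : M.IsCircuit Y)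
    (hYs : Y ⊆ insert x C) (hu : u ∈ C) (huY : u ∉ Y) (hw : w ∈ Y) :
    M.Indep (insert x (C \ {u}) \ {w}) :=
  hY.indep_insert_sdiff (hC.sdiff_singleton_indep hu) (fun h ↦ hxC h.1)
    (subset_insert_sdiff_singleton hYs huY) hw

/-- Contracting `C \ {a, c, d}` turns `C` into the triangle `{a, c, d}`. Exchanges along `X` and `Y`
show that `x` is parallel to none of its points, so `x` is a fourth point on the line. -/
lemma IsCircuit.hasMinorIsoTo_uniformMatroid {a d : α} (hC : M.IsCircuit C)
    (hx : x ∈ M.closure C) (hxC : x ∉ C)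
    (hX : M.IsCircuit X) (hY : M.IsCircuit Y) (hXs : X ⊆ insert x C) (hYs : Y ⊆ insert x C)
    (ha : a ∈ C) (hc : c ∈ C) (hd : d ∈ C) (haX : a ∈ X) (haY : a ∈ Y) (hcX : c ∈ X)
    (hcY : c ∉ Y) (hdX : d ∉ X) (hdY : d ∈ Y) : M.HasMinorIsoTo (uniformMatroid 2 4) := by
  have hac : a ≠ c := by rintro rfl; exact hcY haY
  have had : a ≠ d := by rintro rfl; exact hdX haX
  have hcd : c ≠ d := by rintro rfl; exact hcY hdY
  have hxa : x ≠ a := by rintro rfl; exact hxC ha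
  have hxc : x ≠ c := by rintro rfl; exact hxC hc
  have hxd : x ≠ d := by rintro rfl; exact hxC hd
  have hia : M.Indep (C \ {a}) := hC.sdiff_singleton_indep ha
  have hic : M.Indep (C \ {c}) := hC.sdiff_singleton_indep hc
  have hid : M.Indep (C \ {d}) := hC.sdiff_singleton_indep hd
  have hcdi := hC.indep_insert_sdiff_sdiff hxC hY hYs hc hcY hdY
  have hdai := hC.indep_insert_sdiff_sdiff hxC hX hXs hd hdX haX
  have hcai := hC.indep_insert_sdiff_sdiff hxC hY hYs hc hcY haY
  have hCcl := M.subset_closure C hC.subset_ground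
  have hcl : M.closure C ⊆ M.closure ({a, c} ∪ C \ {a, c, d}) := by
    rw [← hC.closure_sdiff_singleton_eq d]
    exact M.closure_subset_closure (by intro y; simp; grind)
  clear hX hY hXs hYs
  have hZ : M.Indep (C \ {a, c, d}) := hia.subset (by intro y; simp; grind)
  have h4 : Function.Injective ![a, c, d, x] := by
    intro i j
    fin_cases i <;> fin_cases j <;> simp [*, hac.symm, had.symm, hcd.symm, hxa.symm, hxc.symm, hxd.symm]
  have hout : ∀ k, ![a, c, d, x] k ∉ C \ {a, c, d} := by
    intro k
    fin_cases k <;> simp [hxC]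
  refine Matroid.hasMinorIsoTo_uniformMatroid (C \ {a, c, d}) (g := ![a, c, d, x]) h4 ?_ ?_
  · intro i j hij
    rw [hZ.contract_indep_iff]
    refine ⟨?_, ?_⟩
    · rw [Set.disjoint_left]
      rintro _ (rfl | rfl) <;> exact hout _
    fin_cases i <;> fin_cases j <;> first | (exact absurd hij (by decide)) | skip
    · exact hid.subset (by intro y; simp; grind)
    · exact hic.subset (by intro y; simp; grind)
    · exact hcdi.subset (by intro y; simp; grind)
    · exact hia.subset (by intro y; simp; grind)
    · exact hdai.subset (by intro y; simp; grind)
    · exact hcai.subset (by intro y; simp; grind)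
  · intro i
    rw [contract_closure_eq]
    refine ⟨hcl ?_, hout i⟩
    fin_cases i
    · exact hCcl ha
    · exact hCcl hc
    · exact hCcl hd
    · exact hx

/-- Here `x` is contracted too, along with all of `C` except the four chosen elements. What is left
of `X` and `Y` is the parallel pairs `{c, c'}` and `{d, d'}`. -/
lemma IsCircuit.hasMinorIsoTo_sum {c' d d' : α} (hC : M.IsCircuit C) (hxC : x ∉ C)
    (hX : M.IsCircuit X) (hY : M.IsCircuit Y) (hXs : X ⊆ insert x C) (hYs : Y ⊆ insert x C)
    (hXY : ∀ a ∈ C, a ∈ X → a ∉ Y) (hc : c ∈ C) (hc' : c' ∈ C) (hd : d ∈ C) (hd' : d' ∈ C)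
    (hcX : c ∈ X) (hcX' : c' ∈ X) (hdY : d ∈ Y) (hdY' : d' ∈ Y) (hcc' : c' ≠ c)
    (hdd' : d' ≠ d) : M.HasMinorIsoTo ((uniformMatroid 1 2).sum (uniformMatroid 1 2)) := by
  have hdX : d ∉ X := fun h ↦ hXY d hd h hdY
  have hdX' : d' ∉ X := fun h ↦ hXY d' hd' h hdY'
  have hxc : x ≠ c := by rintro rfl; exact hxC hc
  have hxd : x ≠ d := by rintro rfl; exact hxC hd
  have hxc' : x ≠ c' := by rintro rfl; exact hxC hc'
  have hxd' : x ≠ d' := by rintro rfl; exact hxC hd'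
  have hne : ∀ {p q}, p ∈ X → q ∉ X → p ≠ q := by rintro p q hp hq rfl; exact hq hp
  have e1 := hne hcX hdX
  have e2 := hne hcX hdX'
  have e3 := hne hcX' hdX
  have e4 := hne hcX' hdX'
  have hi : ∀ u ∈ C, u ∈ X → ∀ w ∈ Y, M.Indep (insert x (C \ {u}) \ {w}) := fun u hu huX w hw ↦
    hC.indep_insert_sdiff_sdiff hxC hY hYs hu (hXY u hu huX) hw
  have h00 := hi c' hc' hcX' d' hdY'
  have h01 := hi c' hc' hcX' d hdY
  have h10 := hi c hc hcX d' hdY'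
  have h11 := hi c hc hcX d hdY
  have hXZ : X ⊆ {c, c'} ∪ insert x (C \ {c, c', d, d'}) := fun y hy ↦ by
    have := hXs hy
    simp; grind
  have hYZ : Y ⊆ {d, d'} ∪ insert x (C \ {c, c', d, d'}) := fun y hy ↦ by
    have := hYs hy
    simp; grind
  have hZ : M.Indep (insert x (C \ {c, c', d, d'})) := h11.subset (by intro y; simp; grind)
  refine Matroid.hasMinorIsoTo_sum (insert x (C \ {c, c', d, d'})) (a := ![c, c'])
    (d := ![d, d']) ?_ ?_ ?_
  · clear hXs hYs hXY hXZ hYZ hX hY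
    intro i j
    rw [hZ.contract_indep_iff]
    refine ⟨?_, ?_⟩
    · fin_cases i <;> fin_cases j <;>
      simp [Set.disjoint_left, hxc.symm, hxc'.symm, hxd.symm, hxd'.symm]
    fin_cases i <;> fin_cases j
    · exact h00.subset (by intro y; simp; grind)
    · exact h01.subset (by intro y; simp; grind)
    · exact h10.subset (by intro y; simp; grind)
    · exact h11.subset (by intro y; simp; grind)
  · rw [hZ.contract_indep_iff]
    exact fun h ↦ hX.not_indep (h.2.subset hXZ)
  · rw [hZ.contract_indep_iff]
    exact fun h ↦ hY.not_indep (h.2.subset hYZ)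

/-- Otherwise every circuit through `x` inside `C ∪ {x}` has at least two elements of `C`. Two
different such circuits give `U_{2,4}` if they meet inside `C`, and the direct sum if they do not.
-/
lemma exists_parallel_mem_isCircuit
    (h₁ : ¬ M.HasMinorIsoTo (uniformMatroid 2 4))
    (h₂ : ¬ M.HasMinorIsoTo ((uniformMatroid 1 2).sum (uniformMatroid 1 2)))
    (hC : M.IsCircuit C) (hx : x ∈ M.closure C) (hxC : x ∉ C) (hxl : M.IsNonloop x) :
    ∃ c ∈ C, c ∈ M.closure {x} := by
  by_contra! hpar
  have hcl : ∀ u, x ∈ M.closure (C \ {u}) := fun u ↦ by rwa [hC.closure_sdiff_singleton_eq]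
  have hind : ∀ u ∈ C, M.Indep (C \ {u}) := fun u hu ↦ hC.sdiff_singleton_indep hu
  have hxn : ∀ u, x ∉ C \ {u} := fun u h ↦ hxC h.1
  have hfund : ∀ u ∈ C, ∃ X, M.IsCircuit X ∧ x ∈ X ∧ X ⊆ insert x C ∧ u ∉ X := by
    intro u hu
    refine ⟨_, (hind u hu).fundCircuit_isCircuit (hcl u) (hxn u), M.mem_fundCircuit _ _, ?_, ?_⟩
    · exact (M.fundCircuit_subset_insert _ _).trans (Set.insert_subset_insert Set.sdiff_subset)
    · intro h
      rcases M.fundCircuit_subset_insert _ _ h with rfl | h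
      · exact hxC hu
      · exact h.2 rfl
  -- A circuit in `C ∪ {x}` that avoids `u ∈ C` is the fundamental circuit of `x` over the
  -- independent set `C \ {u}`.
  have huniq : ∀ {X Y u}, M.IsCircuit X → M.IsCircuit Y → X ⊆ insert x C → Y ⊆ insert x C →
      u ∈ C → u ∉ X → u ∉ Y → X = Y := by
    intro X Y u hX hY hXs hYs hu huX huY
    rw [hX.eq_fundCircuit_of_subset (hind u hu) (subset_insert_sdiff_singleton hXs huX),
      hY.eq_fundCircuit_of_subset (hind u hu) (subset_insert_sdiff_singleton hYs huY)]
  have hnontriv : ∀ {X c}, M.IsCircuit X → x ∈ X → X ⊆ insert x C → c ∈ X → c ∈ C →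
      ∃ c' ∈ X, c' ∈ C ∧ c' ≠ c := by
    intro X c hX hxX hXs hcX hcC
    by_contra! hcon
    refine hpar c hcC (M.closure_subset_closure ?_ (hX.mem_closure_sdiff_singleton_of_mem hcX))
    rintro y ⟨hy, hyc⟩
    rcases hXs hy with rfl | hyC
    · rfl
    · exact absurd (hcon y hy hyC) hyc
  obtain ⟨d, hd⟩ := hC.nonempty
  obtain ⟨X, hX, hxX, hXs, hdX⟩ := hfund d hd
  obtain ⟨c, hcX, hc⟩ : ∃ c ∈ X, c ∈ C := by
    by_contra! hcon
    refine hX.not_indep (hxl.indep.subset fun y hy ↦ (hXs hy).resolve_right (hcon y hy))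
  obtain ⟨Y, hY, hxY, hYs, hcY⟩ := hfund c hc
  have hXY : X ≠ Y := by
    rintro rfl
    exact hcY hcX
  have hdY : d ∈ Y := by
    by_contra hdY
    exact hXY (huniq hX hY hXs hYs hd hdX hdY)
  by_cases ha : ∃ a ∈ C, a ∈ X ∧ a ∈ Y
  · obtain ⟨a, ha, haX, haY⟩ := ha
    exact h₁ (hC.hasMinorIsoTo_uniformMatroid hx hxC hX hY hXs hYs ha hc hd haX haY hcX hcY hdX hdY)
  push Not at ha
  obtain ⟨c', hcX', hc', hcc'⟩ := hnontriv hX hxX hXs hcX hc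
  obtain ⟨d', hdY', hd', hdd'⟩ := hnontriv hY hxY hYs hdY hd
  exact h₂ (hC.hasMinorIsoTo_sum hxC hX hY hXs hYs ha hc hc' hd hd' hcX hcX' hdY hdY' hcc' hdd')

/-- If `x₀` and `x` were parallel to different elements `c₀` and `c`, contracting all of `C` but
`c`, `c₀` and a third element `b` would leave the parallel pairs `{c₀, x₀}` and `{c, x}`. Omitting
`b` keeps `c` and `c₀` independent after the contraction. -/
lemma exists_common_parallel
    (h₁ : ¬ M.HasMinorIsoTo (uniformMatroid 2 4))
    (h₂ : ¬ M.HasMinorIsoTo ((uniformMatroid 1 2).sum (uniformMatroid 1 2)))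
    (hC : M.IsCircuit C) :
    ∃ c ∈ C, ∀ x ∈ M.closure C, x ∉ C → M.IsNonloop x → c ∈ M.closure {x} := by
  by_cases hex : ∃ x ∈ M.closure C, x ∉ C ∧ M.IsNonloop x
  swap
  · obtain ⟨c, hc⟩ := hC.nonempty
    exact ⟨c, hc, fun x hx hxC hxl ↦ absurd ⟨x, hx, hxC, hxl⟩ hex⟩
  obtain ⟨x₀, hx₀, hx₀C, hx₀l⟩ := hex
  obtain ⟨c₀, hc₀, hcx₀⟩ := exists_parallel_mem_isCircuit h₁ h₂ hC hx₀ hx₀C hx₀l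
  refine ⟨c₀, hc₀, fun x hx hxC hxl ↦ ?_⟩
  obtain ⟨c, hc, hcx⟩ := exists_parallel_mem_isCircuit h₁ h₂ hC hx hxC hxl
  by_cases hcc : c = c₀
  · rwa [← hcc]
  by_cases h3 : ∃ b ∈ C, b ≠ c ∧ b ≠ c₀
  swap
  · push Not at h3
    -- Without a third element, `C = {c, c₀}` is itself a parallel pair, so `x` is parallel to `c₀`
    -- as well.
    refine M.closure_subset_closure_of_subset_closure (Set.singleton_subset_iff.2 hcx)
      (M.closure_subset_closure ?_ (hC.mem_closure_sdiff_singleton_of_mem hc₀))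
    rintro y ⟨hy, hyc⟩
    by_contra hyc'
    exact hyc (h3 y hy hyc')
  exfalso
  obtain ⟨b, hb, hbc, hbc₀⟩ := h3
  have hpar : ∀ {Z p q}, p ∈ M.closure {q} → p ≠ q → ¬ M.Indep ({p, q} ∪ Z) := by
    intro Z p q hpq hne hi
    refine hi.notMem_closure_sdiff_of_mem (e := p) (by simp) (M.closure_subset_closure ?_ hpq)
    simp [hne.symm]
  have hne : ∀ {p q}, p ∈ C → q ∉ C → p ≠ q := by rintro p q hp hq rfl; exact hq hp
  have hZ : M.Indep (C \ {b, c, c₀}) :=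
    (hC.sdiff_singleton_indep hb).subset (by intro y; simp; grind)
  have h00 : M.Indep (insert c₀ (insert c (C \ {b, c, c₀}))) :=
    (hC.sdiff_singleton_indep hb).subset (by intro y; simp; grind)
  have h10 : M.Indep (insert x₀ (insert c (C \ {b, c, c₀}))) :=
    h00.insert_of_parallel (by simp [Ne.symm hcc]) hcx₀ hx₀l.mem_ground
  have h01 : M.Indep (insert x (insert c₀ (C \ {b, c, c₀}))) := by
    rw [Set.insert_comm] at h00
    exact h00.insert_of_parallel (by simp [hcc]) hcx hxl.mem_ground
  have h11 : M.Indep (insert x (insert x₀ (C \ {b, c, c₀}))) := by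
    rw [Set.insert_comm] at h10
    exact h10.insert_of_parallel (by simp [hne hc hx₀C]) hcx hxl.mem_ground
  refine h₂ (hasMinorIsoTo_sum (C \ {b, c, c₀}) (a := ![c₀, x₀]) (d := ![c, x]) ?_ ?_ ?_)
  · intro i j
    rw [hZ.contract_indep_iff]
    refine ⟨?_, ?_⟩
    · fin_cases i <;> fin_cases j <;> simp [Set.disjoint_left, hxC, hx₀C]
    fin_cases i <;> fin_cases j
    · exact h00.subset (by intro y; simp; grind)
    · exact h01.subset (by intro y; simp; grind)
    · exact h10.subset (by intro y; simp; grind)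
    · exact h11.subset (by intro y; simp; grind)
  · rw [hZ.contract_indep_iff]
    exact fun h ↦ hpar hcx₀ (hne hc₀ hx₀C) h.2
  · rw [hZ.contract_indep_iff]
    exact fun h ↦ hpar hcx (hne hc hxC) h.2

lemma isMinimalPartition_of_ground_subset (hE : M.E ⊆ M.loops ∪ M.coloops) :
    M.IsMinimalPartition M.loops ∅ ∅ M.coloops := by
  have hdj : Disjoint M.loops M.coloops :=
    Set.disjoint_left.2 fun e he he' ↦ IsLoop.not_isColoop he he'
  refine ⟨?_, by simpa using hdj, by simp, by simp, fun I hI ↦ ?_⟩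
  · simpa using (Set.union_subset M.loops_subset_ground M.coloops_subset_ground).antisymm hE
  · simp only [Set.inter_empty, Set.subsingleton_empty, Set.not_nonempty_empty, and_false,
      not_false_eq_true, and_true]
    refine ⟨fun h ↦ h.disjoint_loops, fun h ↦ M.coloops_indep.subset fun e he ↦ ?_⟩
    exact (hE (hI he)).resolve_left fun hl ↦ h.le_bot ⟨he, hl⟩

lemma IsCircuit.isMinimalPartition (hC : M.IsCircuit C) (hnt : C.Nontrivial)
    (hE : M.E ⊆ M.closure C ∪ M.coloops) (hc : c ∈ C)
    (hpar : ∀ x ∈ M.closure C, x ∉ C → M.IsNonloop x → c ∈ M.closure {x}) :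
    M.IsMinimalPartition M.loops (C \ {c}) ((M.closure C \ (C \ {c})) \ M.loops) M.coloops := by
  have hCcl := M.subset_closure C hC.subset_ground
  have hCl : ∀ e ∈ C, M.IsNonloop e := fun e he ↦ hC.isNonloop_of_mem hnt he
  have hCK : ∀ e ∈ C, ¬ M.IsColoop e := fun e he ↦ hC.not_isColoop_of_mem he
  have hclK : ∀ e ∈ M.closure C, ¬ M.IsColoop e := fun e he he' ↦
    hCK e (he'.mem_of_mem_closure he) he'
  have hlcl : M.loops ⊆ M.closure C := M.closure_subset_closure (Set.empty_subset C)
  have hpar' : ∀ x ∈ (M.closure C \ (C \ {c})) \ M.loops, c ∈ M.closure {x} := by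
    rintro x ⟨⟨hx, hxC⟩, hxl⟩
    by_cases hxc : x = c
    · rw [hxc]
      exact M.mem_closure_self c (hC.subset_ground hc)
    · exact hpar x hx (fun h ↦ hxC ⟨h, hxc⟩)
        ((M.not_isLoop_iff (mem_ground_of_mem_closure hx)).1 hxl)
  have hpar'' : ∀ x ∈ (M.closure C \ (C \ {c})) \ M.loops, x ∈ M.closure {c} := by
    intro x hx
    have hx' := hpar' x hx
    rw [(hCl c hc).closure_eq_of_mem_closure hx']
    exact M.mem_closure_self x (mem_ground_of_mem_closure hx.1.1)
  refine ⟨?_, ?_, ?_, ?_, fun I hI ↦ ?_⟩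
  · refine Set.Subset.antisymm ?_ fun e he ↦ ?_
    · exact Set.union_subset M.loops_subset_ground (Set.union_subset
        (Set.sdiff_subset.trans hC.subset_ground) (Set.union_subset
        ((Set.sdiff_subset.trans Set.sdiff_subset).trans (M.closure_subset_ground C))
        M.coloops_subset_ground))
    · have := hE he
      simp only [Set.mem_union, Set.mem_sdiff] at this ⊢
      tauto
  · rw [Set.disjoint_left]
    rintro e hel (⟨heC, -⟩ | he | he)
    · exact (hCl e heC).not_isLoop hel
    · exact he.2 hel
    · exact IsLoop.not_isColoop hel he
  · rw [Set.disjoint_left]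
    rintro e he (he' | he')
    · exact he'.1.2 he
    · exact hCK e he.1 he'
  · rw [Set.disjoint_left]
    exact fun e he he' ↦ hclK e he.1.1 he'
  constructor
  · intro h
    refine ⟨h.disjoint_loops, ?_, ?_⟩
    · rintro p ⟨hpI, hp⟩ q ⟨hqI, hq⟩
      by_contra hpq
      refine h.notMem_closure_sdiff_of_mem hpI (M.closure_subset_closure (X := {q}) ?_ ?_)
      · simpa using ⟨hqI, Ne.symm hpq⟩
      · exact M.closure_subset_closure_of_subset_closure
          (Set.singleton_subset_iff.2 (hpar' q hq)) (hpar'' p hp)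
    · rintro ⟨hSI, p, hpI, hp⟩
      refine h.notMem_closure_sdiff_of_mem hpI (M.closure_subset_closure (X := C \ {c}) ?_ ?_)
      · exact Set.subset_sdiff_singleton hSI hp.1.2
      · rw [hC.closure_sdiff_singleton_eq]
        exact hp.1.1
  · rintro ⟨hl, hsub, hS⟩
    rw [← sdiff_coloops_indep_iff]
    have hI' : ∀ e ∈ I \ M.coloops, e ∈ C \ {c} ∨ e ∈ (M.closure C \ (C \ {c})) \ M.loops := by
      rintro e ⟨heI, heK⟩
      have h1 := (hE (hI heI)).resolve_right heK
      have h2 : e ∉ M.loops := fun h ↦ hl.le_bot ⟨heI, h⟩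
      by_cases h3 : e ∈ C \ {c}
      · exact Or.inl h3
      · exact Or.inr ⟨⟨h1, h3⟩, h2⟩
    by_cases hP : ∃ p ∈ I, p ∈ (M.closure C \ (C \ {c})) \ M.loops
    · obtain ⟨p, hpI, hp⟩ := hP
      have : ¬ (C \ {c} ⊆ I) := fun h ↦ hS ⟨h, p, hpI, hp⟩
      obtain ⟨s, hs, hsI⟩ := Set.not_subset.1 this
      -- Some `s ∈ S` is missing from `I`. The proper subset `C \ {s}` of the circuit is
      -- independent, and `c` may be replaced in it by the parallel element `p`.
      have h1 : M.Indep (insert c ((C \ {c}) \ {s})) := by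
        refine (hC.sdiff_singleton_indep hs.1).subset ?_
        rintro y (rfl | hy)
        · exact ⟨hc, fun h ↦ hs.2 h.symm⟩
        · exact ⟨hy.1.1, hy.2⟩
      refine (h1.insert_of_parallel (by simp) (hpar' p hp)
        (mem_ground_of_mem_closure hp.1.1)).subset fun e he ↦ ?_
      rcases hI' e he with h | h
      · exact Or.inr ⟨h, by rintro rfl; exact hsI he.1⟩
      · exact Or.inl (hsub ⟨he.1, h⟩ ⟨hpI, hp⟩)
    · push Not at hP
      refine (hC.sdiff_singleton_indep hc).subset fun e he ↦ ?_
      exact (hI' e he).resolve_right (hP e he.1)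

theorem exists_isMinimalPartition [M.Finite]
    (h₁ : ¬ M.HasMinorIsoTo (uniformMatroid 2 4))
    (h₂ : ¬ M.HasMinorIsoTo ((uniformMatroid 1 2).sum (uniformMatroid 1 2))) :
    ∃ L S P K, M.IsMinimalPartition L S P K := by
  rcases exists_isCircuit_spanning_or_indep h₂ with hE | ⟨C, hC, hE⟩
  · exact ⟨_, _, _, _, isMinimalPartition_of_ground_subset (hE.trans Set.subset_union_right)⟩
  by_cases hnt : C.Nontrivial
  · obtain ⟨c, hc, hpar⟩ := exists_common_parallel h₁ h₂ hC
    exact ⟨_, _, _, _, hC.isMinimalPartition hnt hE hc hpar⟩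
  -- If `C` is a loop, its closure is the set of loops, so every element is a loop or a coloop.
  · rw [Set.not_nontrivial_iff] at hnt
    obtain ⟨c, rfl⟩ := hnt.eq_empty_or_singleton.resolve_left hC.nonempty.ne_empty
    refine ⟨_, _, _, _, isMinimalPartition_of_ground_subset ?_⟩
    rwa [(singleton_isCircuit.1 hC).closure] at hE

end Matroid

/-! ### A partition makes the matroid graphic and Schubert. -/

namespace Matroid

variable {α β V : Type*} {M : Matroid α} {N : Matroid β} {L S P K : Set α}

lemma hasZeroSumVectors_of_isCircuit_iff [Finite V] {G : Graph V α} (hE : G.edgeSet = M.E)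
    (hG : ∀ C, M.IsCircuit C ↔ G.IsCycleEdgeSet C) : M.HasZeroSumVectors G.incVec := by
  intro I hI
  constructor
  · intro h D hD hsum
    by_contra hne
    have hev : G.IsEvenSet D := ⟨Finset.nonempty_iff_ne_empty.2 hne, hE ▸ hD.trans hI, hsum⟩
    obtain ⟨C, hCD, hC⟩ := hev.exists_isCycleEdgeSet
    exact ((hG C).2 hC).not_indep (h.subset (hCD.trans hD))
  · intro h
    by_contra hI'
    obtain ⟨C, hCI, hC⟩ := (show M.Dep I from ⟨hI', hI⟩).exists_isCircuit_subset
    obtain ⟨D, rfl, hD, -⟩ := ((hG C).1 hC).exists_isEvenSet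
    exact hD.1.ne_empty (h D hCI hD.2.2)

lemma HasZeroSumVectors.isCircuit_iff [Finite V] {G : Graph V α} (hE : G.edgeSet = M.E)
    (h : M.HasZeroSumVectors G.incVec) (C : Set α) : M.IsCircuit C ↔ G.IsCycleEdgeSet C := by
  have hdep : ∀ {C}, G.IsCycleEdgeSet C → M.Dep C := by
    intro C hC
    obtain ⟨D, rfl, hD, -⟩ := hC.exists_isEvenSet
    refine ⟨fun hi ↦ ?_, hE ▸ hD.2.1⟩
    exact hD.1.ne_empty ((h _ (hE ▸ hD.2.1)).1 hi D subset_rfl hD.2.2)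
  have heven : ∀ {C}, M.IsCircuit C → ∃ D : Finset α, (D : Set α) = C ∧ G.IsEvenSet D := by
    intro C hC
    obtain ⟨D, rfl, hsum⟩ := h.sum_eq_zero_of_isCircuit hC
    exact ⟨D, rfl, by simpa using hC.nonempty, hE ▸ hC.subset_ground, hsum⟩
  constructor
  · intro hC
    obtain ⟨D, rfl, hD⟩ := heven hC
    obtain ⟨C', hC'D, hC'⟩ := hD.exists_isCycleEdgeSet
    rwa [← hC.eq_of_dep_subset (hdep hC') hC'D]
  · intro hC
    obtain ⟨C', hC'C, hC'⟩ := (hdep hC).exists_isCircuit_subset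
    obtain ⟨D', rfl, hD'⟩ := heven hC'
    obtain ⟨D, rfl, hD, hmin⟩ := hC.exists_isEvenSet
    rwa [← hmin D' (by exact_mod_cast hC'C) hD']

theorem IsGraphic.isBinary (h : M.IsGraphic) : M.IsBinary := by
  obtain ⟨V, _, G, hE, hG⟩ := h
  exact (hasZeroSumVectors_of_isCircuit_iff hE hG).isBinary

section PathVectors

variable {r : ℕ}

/-- The vector of the vertex `i`. -/
def vertexVec (r i : ℕ) : Fin (r + 1) → ZMod 2 := fun v ↦ if v.val = i then 1 else 0

lemma zmod_two_vec_add_self {ι : Type*} (v : ι → ZMod 2) : v + v = 0 :=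
  funext fun _ ↦ CharTwo.add_self_eq_zero _

lemma sum_vertexVec_path (r s : ℕ) :
    ∑ i ∈ Finset.range s, (vertexVec r i + vertexVec r (i + 1)) =
      vertexVec r 0 + vertexVec r s := by
  induction s with
  | zero => simp [zmod_two_vec_add_self]
  | succ s ih =>
    rw [Finset.sum_range_succ, ih, add_assoc, ← add_assoc (vertexVec r s), zmod_two_vec_add_self,
      zero_add]

lemma sum_vertexVec_le {i : ℕ} (hi : i ≤ r) (j : ℕ) :
    ∑ v : Fin (r + 1) with v.val ≤ j, vertexVec r i v = if i ≤ j then 1 else 0 := by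
  have : ∀ v : Fin (r + 1), vertexVec r i v = if v = ⟨i, by omega⟩ then 1 else 0 := by
    intro v
    simp [vertexVec, Fin.ext_iff]
  simp [this]

/-- A cut argument: summing coordinates over the vertices up to `j` counts modulo 2 the edges that
cross the cut after `j`, and `e₀` is the only one. -/
lemma sum_vertexVec_ne_zero {a b : α → ℕ} (ha : ∀ e, a e ≤ r) (hb : ∀ e, b e ≤ r) {D : Finset α}
    {e₀ : α} (he₀ : e₀ ∈ D) (j : ℕ) (h₀ : ¬ (a e₀ ≤ j ↔ b e₀ ≤ j))
    (h : ∀ e ∈ D, e ≠ e₀ → (a e ≤ j ↔ b e ≤ j)) :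
    ∑ e ∈ D, (vertexVec r (a e) + vertexVec r (b e)) ≠ 0 := by
  classical
  intro hsum
  have h1 : ∑ v : Fin (r + 1) with v.val ≤ j,
      (∑ e ∈ D, (vertexVec r (a e) + vertexVec r (b e))) v = 0 := by
    rw [hsum]
    simp
  simp only [Finset.sum_apply, Pi.add_apply] at h1
  rw [Finset.sum_comm] at h1
  simp only [Finset.sum_add_distrib, sum_vertexVec_le (ha _), sum_vertexVec_le (hb _)] at h1
  rw [← Finset.sum_add_distrib] at h1
  have h2 : ∀ e ∈ D, ((if a e ≤ j then 1 else 0) + (if b e ≤ j then 1 else 0) : ZMod 2) =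
      if e = e₀ then 1 else 0 := by
    intro e he
    by_cases h5 : e = e₀
    · subst h5
      by_cases h3 : a e ≤ j <;> by_cases h4 : b e ≤ j <;> simp [h3, h4] at h₀ ⊢
    · have h6 := h e he h5
      by_cases h3 : b e ≤ j
      · simpa [h6, h3, h5] using CharTwo.add_self_eq_zero (1 : ZMod 2)
      · simp [h6, h3, h5]
  rw [Finset.sum_congr rfl h2] at h1
  simp [he₀] at h1

end PathVectors

namespace IsMinimalPartition

lemma mem_cases (h : M.IsMinimalPartition L S P K) {e : α} (he : e ∈ M.E) :
    (e ∈ L ∧ e ∉ S ∧ e ∉ P ∧ e ∉ K) ∨ (e ∉ L ∧ e ∈ S ∧ e ∉ P ∧ e ∉ K) ∨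
      (e ∉ L ∧ e ∉ S ∧ e ∈ P ∧ e ∉ K) ∨ (e ∉ L ∧ e ∉ S ∧ e ∉ P ∧ e ∈ K) := by
  rw [← h.union_eq] at he
  have h1 := fun he : e ∈ L ↦ Set.disjoint_left.1 h.disjoint_left he
  have h2 := fun he : e ∈ S ↦ Set.disjoint_left.1 h.disjoint_middle he
  have h3 := fun he : e ∈ P ↦ Set.disjoint_left.1 h.disjoint_right he
  simp only [Set.mem_union] at he h1 h2
  tauto

lemma subset_ground (h : M.IsMinimalPartition L S P K) :
    L ⊆ M.E ∧ S ⊆ M.E ∧ P ⊆ M.E ∧ K ⊆ M.E := by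
  simp only [← h.union_eq]
  refine ⟨?_, ?_, ?_, ?_⟩ <;> intro e he <;> simp [he]

/-- The graph lives on the path `0, …, r` with `r = s + |K|`. The elements of `S` are the steps from
`0` to `s`, those of `K` the steps from `s` to `r`; elements of `P` join `0` to `s`, and loops sit
at `0`. -/
lemma exists_path_ends [M.Finite] (h : M.IsMinimalPartition L S P K) :
    ∃ (s r : ℕ) (a b : α → ℕ), (∀ e, a e ≤ r) ∧ (∀ e, b e ≤ r) ∧ (∀ e ∈ L, a e = 0 ∧ b e = 0) ∧
      (∀ e ∈ P, a e = 0 ∧ b e = s) ∧ (∀ e ∈ S ∪ K, b e = a e + 1) ∧ Set.InjOn a (S ∪ K) ∧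
      Set.BijOn a S (Set.Iio s) := by
  classical
  obtain ⟨hL, hS, hP, hK⟩ := h.subset_ground
  have hfin : ∀ X ⊆ M.E, ∃ f : α → ℕ, Set.BijOn f X (Set.Iio X.ncard) := fun X hX ↦
    (M.ground_finite.subset hX).exists_bijOn_of_encard_eq (by
      rw [(M.ground_finite.subset hX).cast_ncard_eq.symm, Set.encard_eq_coe_toFinset_card,
        Set.toFinset_Iio, Nat.card_Iio])
  obtain ⟨f, hf⟩ := hfin S hS
  obtain ⟨g, hg⟩ := hfin K hK
  generalize S.ncard = s at hf
  generalize K.ncard = l at hg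
  have hfs : ∀ e ∈ S, f e < s := fun e he ↦ hf.mapsTo he
  have hgl : ∀ e ∈ K, g e < l := fun e he ↦ hg.mapsTo he
  have hSK : ∀ e ∈ K, e ∉ S := by
    intro e he
    rcases h.mem_cases (hK he) with h | h | h | h <;> tauto
  obtain ⟨a, ha⟩ : ∃ a : α → ℕ, ∀ e,
      a e = if e ∈ S then f e else if e ∈ K then s + g e else 0 := ⟨_, fun _ ↦ rfl⟩
  obtain ⟨b, hb⟩ : ∃ b : α → ℕ, ∀ e, b e = if e ∈ S then f e + 1 else
      if e ∈ K then s + g e + 1 else if e ∈ P then s else 0 := ⟨_, fun _ ↦ rfl⟩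
  have haS : ∀ e ∈ S, a e = f e := fun e he ↦ by rw [ha, if_pos he]
  have haK : ∀ e ∈ K, a e = s + g e := fun e he ↦ by rw [ha, if_neg (hSK e he), if_pos he]
  have hout : ∀ e, e ∉ S → e ∉ K → a e = 0 ∧ b e = if e ∈ P then s else 0 := by
    intro e heS heK
    rw [ha, hb, if_neg heS, if_neg heK, if_neg heS, if_neg heK]
    exact ⟨rfl, rfl⟩
  refine ⟨s, s + l, a, b, ?_, ?_, ?_, ?_, ?_, ?_, hf.congr fun e he ↦ (haS e he).symm⟩
  · intro e
    rw [ha]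
    split_ifs with h1 h2
    · have := hfs e h1; omega
    · have := hgl e h2; omega
    · omega
  · intro e
    rw [hb]
    split_ifs with h1 h2
    · have := hfs e h1; omega
    · have := hgl e h2; omega
    · omega
    · omega
  · intro e he
    rcases h.mem_cases (hL he) with h' | h' | h' | h'
    · simpa [h'.2.2.1] using hout e h'.2.1 h'.2.2.2
    all_goals exact absurd he h'.1
  · intro e he
    rcases h.mem_cases (hP he) with h' | h' | h' | h'
    · exact absurd he h'.2.2.1
    · exact absurd he h'.2.2.1
    · simpa [he] using hout e h'.2.1 h'.2.2.2
    · exact absurd he h'.2.2.1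
  · rintro e (he | he)
    · rw [haS e he, hb, if_pos he]
    · rw [haK e he, hb, if_neg (hSK e he), if_pos he]
  · rintro e (he | he) e' (he' | he') hee
    · exact hf.injOn he he' (by rwa [haS e he, haS e' he'] at hee)
    · rw [haS e he, haK e' he'] at hee
      have := hfs e he
      omega
    · rw [haK e he, haS e' he'] at hee
      have := hfs e' he'
      omega
    · exact hg.injOn he he' (by rwa [haK e he, haK e' he', Nat.add_left_cancel_iff] at hee)

theorem isGraphic [M.Finite] (h : M.IsMinimalPartition L S P K) : M.IsGraphic := by
  classical
  obtain ⟨hL, hS, hP, hK⟩ := h.subset_ground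
  obtain ⟨s, r, a, b, ha, hb, haL, haP, hpath, hinj, hbij⟩ := h.exists_path_ends
  have hSK : ∀ e ∈ M.E, e ∉ L → e ∉ P → e ∈ S ∪ K := by
    intro e he heL heP
    rw [Set.mem_union]
    rcases h.mem_cases he with h | h | h | h <;> tauto
  let G : Graph (Fin (r + 1)) α := Graph.ofEnds M.E
    (fun e ↦ ⟨a e, Nat.lt_succ_of_le (ha e)⟩) (fun e ↦ ⟨b e, Nat.lt_succ_of_le (hb e)⟩)
  have hinc : ∀ e ∈ M.E, G.incVec e = vertexVec (r) (a e) + vertexVec (r) (b e) := by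
    intro e he
    rw [(Graph.ofEnds_isLink he).incVec_eq]
    ext v
    simp [vertexVec, Pi.single_apply, Fin.ext_iff]
  refine ⟨Fin (r + 1), inferInstance, G, rfl, HasZeroSumVectors.isCircuit_iff rfl ?_⟩
  intro I hI
  constructor
  · intro hind D hDI hsum
    have hDE := hDI.trans hI
    rw [Finset.sum_congr rfl fun e he ↦ hinc e (hDE he)] at hsum
    by_contra hne
    obtain ⟨hDL, hDP, hDS⟩ := (h.indep_iff _ hDE).1 (hind.subset hDI)
    have hDL' : ∀ e ∈ D, e ∉ L := fun e he heL ↦ hDL.le_bot ⟨he, heL⟩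
    by_cases hp : ∃ p ∈ D, p ∈ P
    · obtain ⟨p, hpD, hpP⟩ := hp
      obtain ⟨q, hqS, hqD⟩ := Set.not_subset.1 fun hSD ↦ hDS ⟨hSD, p, hpD, hpP⟩
      have hqs : a q < s := hbij.mapsTo hqS
      -- The step `q` of the segment is absent from `D`, so `p` alone crosses the cut there.
      refine sum_vertexVec_ne_zero ha hb hpD (a q) ?_ ?_ hsum
      · simp only [haP p hpP]
        omega
      · intro e he hep
        have heP : e ∉ P := fun heP ↦ hep (hDP ⟨he, heP⟩ ⟨hpD, hpP⟩)
        have h1 := hpath e (hSK e (hDE he) (hDL' e he) heP)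
        have h2 : a e ≠ a q := by
          intro haq
          rw [hinj (hSK e (hDE he) (hDL' e he) heP) (Or.inl hqS) haq] at he
          exact hqD he
        omega
    · push Not at hp
      obtain ⟨e₀, he₀⟩ := Finset.nonempty_iff_ne_empty.2 hne
      -- Now `D` consists of distinct steps of the path, and the cut at `e₀` is crossed by `e₀`
      -- only.
      refine sum_vertexVec_ne_zero ha hb he₀ (a e₀) ?_ ?_ hsum
      · have := hpath e₀ (hSK e₀ (hDE he₀) (hDL' e₀ he₀) (hp e₀ he₀))
        omega
      · intro e he hee
        have h1 := hpath e (hSK e (hDE he) (hDL' e he) (hp e he))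
        have h2 : a e ≠ a e₀ := fun haa ↦ hee (hinj (hSK e (hDE he) (hDL' e he) (hp e he))
          (hSK e₀ (hDE he₀) (hDL' e₀ he₀) (hp e₀ he₀)) haa)
        omega
  · intro hD
    rw [h.indep_iff I hI]
    refine ⟨?_, ?_, ?_⟩
    · rw [Set.disjoint_left]
      intro e heI heL
      have := hD {e} (by simpa using heI) (by simp [hinc e (hL heL), haL e heL, zmod_two_vec_add_self])
      simp at this
    · rintro p ⟨hpI, hp⟩ q ⟨hqI, hq⟩
      by_contra hpq
      have := hD {p, q} (by simp [Set.insert_subset_iff, hpI, hqI]) (by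
        rw [Finset.sum_pair hpq, hinc p (hP hp), hinc q (hP hq)]
        simp only [haP p hp, haP q hq]
        exact zmod_two_vec_add_self _)
      simp at this
    · rintro ⟨hSI, p, hpI, hp⟩
      have hSfin : S.Finite := M.ground_finite.subset hS
      have hpS : p ∉ S := by
        rcases h.mem_cases (hP hp) with h | h | h | h <;> tauto
      have := hD (insert p hSfin.toFinset) (by simp [Set.insert_subset_iff, hpI, hSI]) (by
        rw [Finset.sum_insert (by simpa using hpS)]
        have hsum : ∑ e ∈ hSfin.toFinset, G.incVec e =
            ∑ i ∈ Finset.range s, (vertexVec (r) i + vertexVec (r) (i + 1)) := by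
          refine Finset.sum_nbij a ?_ ?_ ?_ ?_
          · intro e he
            simpa using hbij.mapsTo (show e ∈ S by simpa using he)
          · simpa using hbij.injOn
          · simpa using hbij.surjOn
          · intro e he
            have heS : e ∈ S := by simpa using he
            rw [hinc e (hS heS), hpath e (Or.inl heS)]
        rw [hsum, sum_vertexVec_path, hinc p (hP hp), (haP p hp).1, (haP p hp).2]
        exact zmod_two_vec_add_self _)
      simp at this

/-- Every flat contains `L`, and contains `P` once it meets `P`. A cyclic flat avoids `K`, and
contains `L ∪ S ∪ P` once it meets `S`. Only three candidates remain, and they are nested. -/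
theorem isSchubert (h : M.IsMinimalPartition L S P K) : M.IsSchubert := by
  obtain ⟨hL, hS, hP, hK⟩ := h.subset_ground
  have hLF : ∀ F, M.IsFlat F → L ⊆ F := by
    intro F hF e he
    have hloop : M.IsLoop e := by
      rw [← singleton_not_indep (hL he), h.indep_iff _ (by simpa using hL he)]
      simp [he]
    exact hF.closure ▸ M.closure_subset_closure (Set.empty_subset F) hloop
  have hPF : ∀ F, M.IsFlat F → (F ∩ P).Nonempty → P ⊆ F := by
    rintro F hF ⟨p, hpF, hp⟩ q hq
    by_contra hqF
    obtain ⟨I, hI⟩ := M.exists_isBasis F hF.subset_ground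
    have hqI : q ∉ I := fun hqI ↦ hqF (hI.subset hqI)
    have hqi : M.Indep (insert q I) := by
      rw [hI.indep.insert_indep_iff_of_notMem hqI, hI.closure_eq_closure, hF.closure]
      exact ⟨hP hq, hqF⟩
    obtain ⟨h1, h2, h3⟩ := (h.indep_iff _ hqi.subset_ground).1 hqi
    have hIP : ∀ e ∈ I, e ∉ P := by
      intro e he heP
      have := h2 ⟨Or.inr he, heP⟩ ⟨Or.inl rfl, hq⟩
      exact hqI (this ▸ he)
    have hIS : ¬ S ⊆ I := fun hSI ↦ h3 ⟨hSI.trans (Set.subset_insert _ _), q, Or.inl rfl, hq⟩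
    have hpS : p ∉ S := by rcases h.mem_cases (hP hp) with h | h | h | h <;> tauto
    have hpL : p ∉ L := by rcases h.mem_cases (hP hp) with h | h | h | h <;> tauto
    -- Independence treats all elements of `P` alike, so `p` can take the place of `q`. Since `I` is
    -- a basis of `F ∋ p`, this forces `p ∈ I`, although `I` avoids `P`.
    have hpi : M.Indep (insert p I) := by
      rw [h.indep_iff _ (Set.insert_subset (hP hp) hI.indep.subset_ground)]
      refine ⟨?_, ?_, ?_⟩
      · rw [Set.disjoint_left]
        rintro e (rfl | he) heL
        · exact hpL heL
        · exact h1.le_bot ⟨Or.inr he, heL⟩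
      · rintro e ⟨rfl | he, heP⟩ e' ⟨rfl | he', heP'⟩
        · rfl
        · exact absurd heP' (hIP _ he')
        · exact absurd heP (hIP _ he)
        · exact absurd heP (hIP _ he)
      · exact fun hSp ↦ hIS ((Set.subset_insert_iff_of_notMem hpS).1 hSp.1)
    exact hIP p (hI.mem_of_insert_indep hpF hpi) hp
  -- Deleting `e` from the circuit changes neither its trace on `P` nor, if `e ∉ S`, whether it
  -- contains `S`. Hence the obstruction to independence must be `S` together with an element of
  -- `P`, and `e` must belong to `S`.
  have hsame : ∀ C e, M.IsCircuit C → e ∈ C → e ∉ L → e ∉ P → e ∈ S ∧ S ⊆ C ∧ (C ∩ P).Nonempty := by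
    intro C e hC he heL heP
    have hi := hC.sdiff_singleton_indep he
    obtain ⟨h1, h2, h3⟩ := (h.indep_iff _ hi.subset_ground).1 hi
    have hCP : (C \ {e}) ∩ P = C ∩ P := by
      ext y
      simp only [Set.mem_inter_iff, Set.mem_sdiff, Set.mem_singleton_iff]
      refine ⟨fun hy ↦ ⟨hy.1.1, hy.2⟩, fun hy ↦ ⟨⟨hy.1, ?_⟩, hy.2⟩⟩
      rintro rfl
      exact heP hy.2
    rw [hCP] at h2 h3
    have hCL : Disjoint C L := by
      rw [Set.disjoint_left]
      intro y hy hyL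
      refine h1.le_bot ⟨⟨hy, ?_⟩, hyL⟩
      rintro rfl
      exact heL hyL
    have h4 : S ⊆ C ∧ (C ∩ P).Nonempty := by
      by_contra h4
      exact hC.not_indep ((h.indep_iff C hC.subset_ground).2 ⟨hCL, h2, h4⟩)
    refine ⟨?_, h4⟩
    by_contra heS
    exact h3 ⟨Set.subset_sdiff_singleton h4.1 heS, h4.2⟩
  have hKF : ∀ F, M.IsCyclicFlat F → ∀ e ∈ F, e ∈ L ∪ S ∪ P := by
    rintro _ ⟨hF, 𝒞, h𝒞, rfl⟩ e ⟨C, hC, heC⟩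
    by_contra he
    simp only [Set.mem_union, not_or] at he
    exact he.1.2 (hsame C e (h𝒞 C hC) heC he.1.1 he.2).1
  have hSF : ∀ F, M.IsCyclicFlat F → (F ∩ S).Nonempty → L ∪ S ∪ P ⊆ F := by
    rintro _ ⟨hF, 𝒞, h𝒞, rfl⟩ ⟨e, ⟨C, hC, heC⟩, heS⟩
    have heLP : e ∉ L ∧ e ∉ P := by
      rcases h.mem_cases (hS heS) with h | h | h | h <;> tauto
    obtain ⟨-, h1, p, hpC, hp⟩ := hsame C e (h𝒞 C hC) heC heLP.1 heLP.2
    refine Set.union_subset (Set.union_subset (hLF _ hF) ?_) (hPF _ hF ⟨p, ⟨C, hC, hpC⟩, hp⟩)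
    exact h1.trans (Set.subset_sUnion_of_mem hC)
  intro F hF G hG _
  by_cases hFS : (F ∩ S).Nonempty
  · exact Or.inr fun e he ↦ hSF F hF hFS (hKF G hG e he)
  by_cases hGS : (G ∩ S).Nonempty
  · exact Or.inl fun e he ↦ hSF G hG hGS (hKF F hF e he)
  have hFLP : ∀ F, M.IsCyclicFlat F → ¬ (F ∩ S).Nonempty → ∀ e ∈ F, e ∈ L ∨ e ∈ P := by
    intro F hF hFS e he
    rcases hKF F hF e he with (h | h) | h
    · exact Or.inl h
    · exact absurd ⟨e, he, h⟩ hFS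
    · exact Or.inr h
  by_cases hFP : (F ∩ P).Nonempty
  · refine Or.inr fun e he ↦ ?_
    rcases hFLP G hG hGS e he with h | h
    · exact hLF F hF.1 h
    · exact hPF F hF.1 hFP h
  · refine Or.inl fun e he ↦ ?_
    rcases hFLP F hF hFS e he with h | h
    · exact hLF G hG.1 h
    · exact absurd ⟨e, he, h⟩ hFP

lemma image_iff {L₀ S₀ P₀ K₀ : Set β} (h₀ : N.IsMinimalPartition L₀ S₀ P₀ K₀) (hN : N.E = Set.univ)
    {g : β → α} (hg : Function.Injective g) (hr : Set.range g = M.E) :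
    M.IsMinimalPartition (g '' L₀) (g '' S₀) (g '' P₀) (g '' K₀) ↔
      ∀ J, M.Indep (g '' J) ↔ N.Indep J := by
  have hiff : ∀ J : Set β, (Disjoint (g '' J) (g '' L₀) ∧ (g '' J ∩ g '' P₀).Subsingleton ∧
      ¬ (g '' S₀ ⊆ g '' J ∧ (g '' J ∩ g '' P₀).Nonempty)) ↔ N.Indep J := by
    intro J
    rw [h₀.indep_iff J (hN ▸ Set.subset_univ J), Set.disjoint_image_iff hg,
      ← Set.image_inter hg, Set.image_nonempty, Set.image_subset_image_iff hg,
      hg.subsingleton_image_iff]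
  constructor
  · intro h J
    rw [← hiff, h.indep_iff _ (hr ▸ Set.image_subset_range g J)]
  · intro h
    refine ⟨?_, ?_, ?_, ?_, fun I hI ↦ ?_⟩
    · simp only [← Set.image_union]
      rw [h₀.union_eq, hN, Set.image_univ, hr]
    · simpa only [← Set.image_union, Set.disjoint_image_iff hg] using h₀.disjoint_left
    · simpa only [← Set.image_union, Set.disjoint_image_iff hg] using h₀.disjoint_middle
    · simpa only [Set.disjoint_image_iff hg] using h₀.disjoint_right
    · obtain ⟨J, rfl⟩ : ∃ J, g '' J = I := ⟨g ⁻¹' I, Set.image_preimage_eq_of_subset (hr ▸ hI)⟩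
      rw [h, hiff]

end IsMinimalPartition

end Matroid

/-! ### Partitions are classified by their cardinalities. -/

lemma Set.BijOn.exists_union {α β : Type*} {f f' : β → α} {s s' : Set β} {t t' : Set α}
    (hf : Set.BijOn f s t) (hf' : Set.BijOn f' s' t') (hs : Disjoint s s') (ht : Disjoint t t') :
    ∃ g, Set.EqOn g f s ∧ Set.EqOn g f' s' ∧ Set.BijOn g (s ∪ s') (t ∪ t') := by
  classical
  have h1 : Set.EqOn (s.piecewise f f') f s := Set.piecewise_eqOn _ _ _
  have h2 : Set.EqOn (s.piecewise f f') f' s' :=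
    (Set.piecewise_eqOn_compl _ _ _).mono hs.subset_compl_left
  have hb := hf.congr h1.symm
  have hb' := hf'.congr h2.symm
  refine ⟨_, h1, h2, hb.union hb' ?_⟩
  rw [Set.injOn_union hs]
  exact ⟨hb.injOn, hb'.injOn, fun a ha b hb'' hab ↦
    ht.le_bot ⟨hb.mapsTo ha, hab ▸ hb'.mapsTo hb''⟩⟩

namespace Matroid

variable {α β : Type*} {M : Matroid α} {N : Matroid β} {L S P K : Set α} {L₀ S₀ P₀ K₀ : Set β}

theorem IsMinimalPartition.isIsomorphicTo [Finite β] (h : M.IsMinimalPartition L S P K)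
    (h₀ : N.IsMinimalPartition L₀ S₀ P₀ K₀) (hN : N.E = Set.univ)
    (hL : L₀.encard = L.encard) (hS : S₀.encard = S.encard) (hP : P₀.encard = P.encard)
    (hK : K₀.encard = K.encard) : M.IsIsomorphicTo N := by
  rw [isIsomorphicTo_iff_exists_injective hN]
  -- A bijection between subsets is produced as a total function into `α`, which needs `α` to be
  -- nonempty.
  rcases isEmpty_or_nonempty α with hα | hα
  · have hβ : IsEmpty β := by
      rw [Set.eq_empty_of_isEmpty L, Set.encard_empty, Set.encard_eq_zero] at hL
      rw [Set.eq_empty_of_isEmpty S, Set.encard_empty, Set.encard_eq_zero] at hS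
      rw [Set.eq_empty_of_isEmpty P, Set.encard_empty, Set.encard_eq_zero] at hP
      rw [Set.eq_empty_of_isEmpty K, Set.encard_empty, Set.encard_eq_zero] at hK
      rw [← Set.univ_eq_empty_iff, ← hN, ← h₀.union_eq, hL, hS, hP, hK]
      simp
    refine ⟨isEmptyElim, fun a ↦ isEmptyElim a, Subsingleton.elim _ _, fun J ↦ ?_⟩
    rw [Set.eq_empty_of_isEmpty J]
    simp
  obtain ⟨fL, hfL⟩ := (Set.toFinite L₀).exists_bijOn_of_encard_eq hL
  obtain ⟨fS, hfS⟩ := (Set.toFinite S₀).exists_bijOn_of_encard_eq hS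
  obtain ⟨fP, hfP⟩ := (Set.toFinite P₀).exists_bijOn_of_encard_eq hP
  obtain ⟨fK, hfK⟩ := (Set.toFinite K₀).exists_bijOn_of_encard_eq hK
  obtain ⟨f₁, h₁P, h₁K, h₁⟩ := hfP.exists_union hfK h₀.disjoint_right h.disjoint_right
  obtain ⟨f₂, h₂S, h₂₁, h₂⟩ := hfS.exists_union h₁ h₀.disjoint_middle h.disjoint_middle
  obtain ⟨g, hgL, hg₂, hg⟩ := hfL.exists_union h₂ h₀.disjoint_left h.disjoint_left
  rw [h.union_eq, h₀.union_eq, hN] at hg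
  have hinj : Function.Injective g := Set.injOn_univ.1 hg.injOn
  have hr : Set.range g = M.E := by rw [← Set.image_univ, hg.image_eq]
  refine ⟨g, hinj, hr, (h₀.image_iff hN hinj hr).1 ?_⟩
  have e1 : g '' L₀ = L := hgL.image_eq.trans hfL.image_eq
  have e2 : g '' S₀ = S := by
    rw [(hg₂.mono Set.subset_union_left).image_eq, h₂S.image_eq, hfS.image_eq]
  have hg₁ : Set.EqOn g f₁ (P₀ ∪ K₀) := (hg₂.mono Set.subset_union_right).trans h₂₁
  have e3 : g '' P₀ = P := by
    rw [(hg₁.mono Set.subset_union_left).image_eq, h₁P.image_eq, hfP.image_eq]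
  have e4 : g '' K₀ = K := by
    rw [(hg₁.mono Set.subset_union_right).image_eq, h₁K.image_eq, hfK.image_eq]
  rwa [e1, e2, e3, e4]

lemma encard_fin_lt {k n : ℕ} (hkn : k ≤ n) : ({i | i.val < k} : Set (Fin n)).encard = k := by
  have h : ({i | i.val < k} : Set (Fin n)) = Set.range (Fin.castLE hkn) := by
    ext i
    simp only [Set.mem_ofPred_eq, Set.mem_range]
    exact ⟨fun h ↦ ⟨⟨i.val, h⟩, rfl⟩, fun ⟨j, hj⟩ ↦ hj ▸ j.isLt⟩
  rw [h, ← Set.image_univ, (Fin.castLE_injective hkn).encard_image]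
  simp

lemma encard_fin_le (k n : ℕ) : ({i | k ≤ i.val} : Set (Fin n)).encard = (n - k : ℕ) := by
  have h : ({i | k ≤ i.val} : Set (Fin n)) =
      Set.range (fun j : Fin (n - k) ↦ (⟨k + j, by omega⟩ : Fin n)) := by
    ext i
    simp only [Set.mem_ofPred_eq, Set.mem_range]
    exact ⟨fun h ↦ ⟨⟨i.val - k, by omega⟩, Fin.ext (by simp; omega)⟩, fun ⟨j, hj⟩ ↦ by simp [← hj]⟩
  have hinj : Function.Injective (fun j : Fin (n - k) ↦ (⟨k + j, by omega⟩ : Fin n)) := by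
    intro i j hij
    simp only [Fin.mk.injEq] at hij
    exact Fin.ext (by omega)
  rw [h, ← Set.image_univ, hinj.encard_image]
  simp

/-- With at most one element outside the first `k`, the bound `k` on the size is exceeded only by
all of the first `k` and one more. -/
lemma minimalMatroid_indep_iff_subsingleton {k n : ℕ} (hkn : k ≤ n) {I : Set (Fin n)} :
    (minimalMatroid k n).Indep I ↔ (I ∩ {i | k ≤ i.val}).Subsingleton ∧
      ¬ ({i | i.val < k} ⊆ I ∧ (I ∩ {i | k ≤ i.val}).Nonempty) := by
  have hsplit : (I ∩ {i | i.val < k}).ncard + (I ∩ {i | k ≤ i.val}).ncard = I.ncard := by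
    rw [← Set.ncard_inter_add_ncard_sdiff_eq_ncard I {i | i.val < k} (Set.toFinite _)]
    congr 2
    ext i
    simp
  have hF : ({i | i.val < k} : Set (Fin n)).ncard = k := by
    rw [Set.ncard, encard_fin_lt hkn]
    rfl
  have hle : (I ∩ {i | i.val < k}).ncard ≤ k :=
    (Set.ncard_le_ncard Set.inter_subset_right (Set.toFinite _)).trans hF.le
  have hfull : {i | i.val < k} ⊆ I ↔ (I ∩ {i | i.val < k}).ncard = k := by
    rw [← Set.inter_eq_right]
    refine ⟨fun h ↦ by rw [h, hF], fun h ↦ ?_⟩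
    exact Set.eq_of_subset_of_ncard_le Set.inter_subset_right (by omega) (Set.toFinite _)
  rw [minimalMatroid_indep_iff, hfull, ← Set.ncard_pos (Set.toFinite _),
    ← Set.ncard_le_one_iff_subsingleton]
  change _ ∧ (I ∩ {i | k ≤ i.val}).ncard ≤ 1 ↔ _
  omega

lemma minimalWithLoopsColoops_ground (m k n l : ℕ) :
    (minimalWithLoopsColoops m k n l).E = Set.univ := by
  ext (i | i | i) <;> simp [minimalWithLoopsColoops]

lemma isMinimalPartition_minimalWithLoopsColoops (m l : ℕ) {k n : ℕ} (hkn : k ≤ n) :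
    (minimalWithLoopsColoops m k n l).IsMinimalPartition (Set.range Sum.inl)
      ((fun i ↦ Sum.inr (Sum.inl i)) '' {i | i.val < k})
      ((fun i ↦ Sum.inr (Sum.inl i)) '' {i | k ≤ i.val})
      (Set.range fun i ↦ Sum.inr (Sum.inr i)) := by
  refine ⟨?_, ?_, ?_, ?_, fun I _ ↦ ?_⟩
  · rw [minimalWithLoopsColoops_ground]
    ext (i | i | i) <;> simp [lt_or_ge]
  · rw [Set.disjoint_left]
    rintro _ ⟨i, rfl⟩
    simp
  · rw [Set.disjoint_left]
    rintro _ ⟨i, hi, rfl⟩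
    simpa using hi
  · rw [Set.disjoint_left]
    rintro _ ⟨i, hi, rfl⟩
    simp
  · have hinj : Function.Injective (fun i : Fin n ↦ (Sum.inr (Sum.inl i) : Fin m ⊕ (Fin n ⊕ Fin l))) :=
      fun i j h ↦ by simpa using h
    have hI : I ∩ ((fun i ↦ Sum.inr (Sum.inl i)) '' {i : Fin n | k ≤ i.val}) =
        (fun i ↦ Sum.inr (Sum.inl i)) '' ((Sum.inl ⁻¹' (Sum.inr ⁻¹' I)) ∩ {i | k ≤ i.val}) := by
      ext (i | i | i) <;> simp
    rw [hI, Set.image_nonempty, hinj.subsingleton_image_iff, Set.image_subset_iff]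
    have hl : (Sum.inr ⁻¹' (Sum.inr ⁻¹' I) : Set (Fin l)).ncard ≤ l := by
      simpa using Set.ncard_le_ncard (Set.subset_univ (Sum.inr ⁻¹' (Sum.inr ⁻¹' I) : Set (Fin l)))
    have hL : (Sum.inl ⁻¹' I : Set (Fin m)).ncard ≤ 0 ↔ Disjoint I (Set.range Sum.inl) := by
      rw [Nat.le_zero, Set.ncard_eq_zero (Set.toFinite _), Set.preimage_eq_empty_iff]
    simp only [minimalWithLoopsColoops, sum_indep_iff, uniformMatroid_indep_iff, hl, and_true, hL,
      minimalMatroid_indep_iff_subsingleton hkn]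
    rfl

/-- This gives the rank as `|S| + |K|`, which links the partition to the parameter `k`. -/
lemma IsMinimalPartition.isBase (h : M.IsMinimalPartition L S P K) : M.IsBase (S ∪ K) := by
  obtain ⟨hL, hS, hP, hK⟩ := h.subset_ground
  have hP' : (S ∪ K) ∩ P = ∅ := by
    ext e
    simp only [Set.mem_inter_iff, Set.mem_union, Set.mem_empty_iff_false, iff_false]
    rintro ⟨he, heP⟩
    rcases h.mem_cases (hP heP) with h | h | h | h <;> tauto
  have hi : M.Indep (S ∪ K) := by
    rw [h.indep_iff _ (Set.union_subset hS hK), hP']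
    refine ⟨?_, by simp, by simp⟩
    rw [Set.disjoint_left]
    intro e he heL
    rw [Set.mem_union] at he
    rcases h.mem_cases (hL heL) with h | h | h | h <;> tauto
  refine hi.isBase_of_forall_insert fun e he hins ↦ ?_
  obtain ⟨h1, -, h3⟩ := (h.indep_iff _ hins.subset_ground).1 hins
  have he' : e ∉ S ∧ e ∉ K := by simpa using he.2
  rcases h.mem_cases he.1 with h | h | h | h
  · exact h1.le_bot ⟨Set.mem_insert _ _, h.1⟩
  · exact he'.1 h.2.1
  · exact h3 ⟨fun x hx ↦ Or.inr (Or.inl hx), e, Set.mem_insert _ _, h.2.2.1⟩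
  · exact he'.2 h.2.2.2

theorem exists_isMinimalPartition_iff {k n : ℕ} (hn : M.E.encard = (n : ℕ∞))
    (hk : M.eRank = (k : ℕ∞)) :
    (∃ L S P K, M.IsMinimalPartition L S P K) ↔ ∃ l m : ℕ, l ≤ k ∧ k + m ≤ n ∧
      M.IsIsomorphicTo (minimalWithLoopsColoops m (k - l) (n - l - m) l) := by
  constructor
  · rintro ⟨L, S, P, K, h⟩
    obtain ⟨hL, hS, hP, hK⟩ := h.subset_ground
    have hfin : M.E.Finite := Set.finite_of_encard_eq_coe hn
    have hcast : ∀ {X}, X ⊆ M.E → X.encard = (X.ncard : ℕ∞) := fun hX ↦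
      (hfin.subset hX).cast_ncard_eq.symm
    have hrank : S.ncard + K.ncard = k := by
      have h1 := h.isBase.encard_eq_eRank
      rw [Set.encard_union_eq (h.disjoint_middle.mono_right Set.subset_union_right), hk, hcast hS,
        hcast hK] at h1
      exact_mod_cast h1
    have hcard : L.ncard + (S.ncard + (P.ncard + K.ncard)) = n := by
      have h1 := hn
      rw [← h.union_eq, Set.encard_union_eq h.disjoint_left, Set.encard_union_eq h.disjoint_middle,
        Set.encard_union_eq h.disjoint_right, hcast hL, hcast hS, hcast hP, hcast hK] at h1
      exact_mod_cast h1
    -- With `l = |K|` and `m = |L|`, the differences are exact: `k - l = |S|` and `n - l - m = |S| +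
    -- |P|`.
    refine ⟨K.ncard, L.ncard, by omega, by omega, ?_⟩
    have hinj : ∀ n', Function.Injective
        (fun i : Fin n' ↦ (Sum.inr (Sum.inl i) : Fin L.ncard ⊕ (Fin n' ⊕ Fin K.ncard))) :=
      fun n' i j h ↦ by simpa using h
    have hinj' : ∀ n', Function.Injective
        (fun i : Fin K.ncard ↦ (Sum.inr (Sum.inr i) : Fin L.ncard ⊕ (Fin n' ⊕ Fin K.ncard))) :=
      fun n' i j h ↦ by simpa using h
    refine h.isIsomorphicTo (isMinimalPartition_minimalWithLoopsColoops _ _ (by omega))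
      (minimalWithLoopsColoops_ground _ _ _ _) ?_ ?_ ?_ ?_
    · rw [← Set.image_univ, Sum.inl_injective.encard_image, hcast hL]
      simp
    · rw [(hinj _).encard_image, encard_fin_lt (by omega), hcast hS]
      congr 1
      omega
    · rw [(hinj _).encard_image, encard_fin_le, hcast hP]
      congr 1
      omega
    · rw [← Set.image_univ, (hinj' _).encard_image, hcast hK]
      simp
  · rintro ⟨l, m, hl, hm, hiso⟩
    have hE := minimalWithLoopsColoops_ground m (k - l) (n - l - m) l
    obtain ⟨g, hg, hr, hJ⟩ := (isIsomorphicTo_iff_exists_injective hE).1 hiso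
    exact ⟨_, _, _, _, ((isMinimalPartition_minimalWithLoopsColoops m l (by omega)).image_iff
      hE hg hr).2 hJ⟩

end Matroid

theorem mainTheorem10 {α : Type*} (M : Matroid α) (k n : ℕ)
    (hn : M.E.encard = (n : ℕ∞)) (hk : M.eRank = (k : ℕ∞)) :
    List.TFAE [
      ∃ l m : ℕ, l ≤ k ∧ k + m ≤ n ∧
        M.IsIsomorphicTo (Matroid.minimalWithLoopsColoops m (k - l) (n - l - m) l),
      ¬ M.HasMinorIsoTo (Matroid.uniformMatroid 2 4) ∧
        ¬ M.HasMinorIsoTo ((Matroid.uniformMatroid 1 2).sum (Matroid.uniformMatroid 1 2)),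
      M.IsBinary ∧ M.IsSchubert,
      M.IsGraphic ∧ M.IsSchubert] := by
  have : M.Finite := ⟨Set.finite_of_encard_eq_coe hn⟩
  rw [← Matroid.exists_isMinimalPartition_iff hn hk]
  tfae_have 1 → 4 := fun ⟨_, _, _, _, h⟩ ↦ ⟨h.isGraphic, h.isSchubert⟩
  tfae_have 4 → 3 := fun h ↦ ⟨h.1.isBinary, h.2⟩
  tfae_have 3 → 2 := fun h ↦ ⟨h.1.not_hasMinorIsoTo_uniformMatroid, h.2.not_hasMinorIsoTo_sum⟩
  tfae_have 2 → 1 := fun h ↦ Matroid.exists_isMinimalPartition h.1 h.2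
  tfae_finish
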